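/- Let ${\bf u}=2^{-53}$. For $X=(x_{ij})\in\mathbb{R}^{m\times n}$ let $c=\max_{i,j}|x_{ij}|$, let $[X]_g$ be the largest Euclidean norm of a column of $X$, let $\|\cdot\|_2$ and $\|\cdot\|_F$ be the spectral and the Frobenius norm, and put $p=[X]_g/\|X\|_2$ and $\kappa_2(X)=\|X\|_2/\sigma_{\min}(X)$. $X$ is a sparse matrix with parameters $v,t_1,t_2$ ($0\le v<n$, $0<t_2<t_1\le m$) if it has $v$ dense columns, each with at most $t_1$ nonzero entries, and each of the remaining columns has at most $t_2$ nonzero entries; it is a $T_2$ matrix if $v=0$. For such $X$ put $$j_s=\min\bigl(11(m{\bf u}+(n+1){\bf u})\,(vt_1+nt_2)c^2,\ 11(mn{\bf u}+n(n+1){\bf u})[X]_g^2\bigr).$$ Shifted CholeskyQR3 with shift $s$, $[Q,R]=\mathrm{SCholeskyQR3}(X)$, is the following algorithm: (1) $G=X^\top X$, $Y=\mathrm{Cholesky}(G+sI)$ (upper triangular), $W=XY^{-1}$; (2) $[V,D]=\mathrm{CholeskyQR}(W)$ and $[Q,J]=\mathrm{CholeskyQR}(V)$, where $\mathrm{CholeskyQR}(A)$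 returns $AR_A^{-1}$ and $R_A=\mathrm{Cholesky}(A^\top A)$; (3) $Z=JD$, $R=ZY$. It is carried out in a floating-point arithmetic in which each of the operations $+,-,\times,/,\sqrt{\cdot}$ returns the exact result up to a relative error of at most ${\bf u}$. Inner products are computed by recursive summation, $XY^{-1}$ row by row by substitution, and Cholesky factorization row by row; it breaks down if a computed pivot is not positive. **Theorem.** Let $X\in\mathbb{R}^{m\times n}$ be a $T_2$ matrix. Then $$j_s=11(mn{\bf u}+n(n+1){\bf u})[X]_g^2 .$$ Suppose moreover that $X$ has full column rank, $mn{\bf u}\le\frac1{64}$ and $n(n+1){\bf u}\le\frac1{64}$. Then $\frac1{\sqrt n}\le p\le 1$ and $$\frac{1}{86p(mn{\bf u}+n(n+1){\bf u})}\le\frac{1}{4.89\,pn^2{\bf u}},$$ and the condition $$\kappa_2(X)\le\frac{1}{86p(mn{\bf u}+n(n+1){\bf u})}$$ is sufficient for Shifted CholeskyQR3 with $s=j_s$: in every such arithmetic it runs to completion, and the computed factors $Q$, $R$ satisfy $$\|Q^\top Q-I\|_F\le 6(mn{\bf u}+n(n+1){\bf u}),\qquad \|QR-X\|_F\le(6.57p+4.81)\,n^2{\bf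 u}\,\|X\|_2 .$$ -/

import Mathlib

namespace SparseCholeskyQR

/-! ### Norms, singular values, condition number -/

/-- The spectral norm: the operator norm of `X` between Euclidean spaces. -/
noncomputable def norm2 {m n : ℕ} (X : Matrix (Fin m) (Fin n) ℝ) : ℝ :=
  ‖(Matrix.toEuclideanLin X).toContinuousLinearMap‖

/-- The Frobenius norm. -/
noncomputable def normF {m n : ℕ} (X : Matrix (Fin m) (Fin n) ℝ) : ℝ :=
  Real.sqrt (∑ i, ∑ j, X i j ^ 2)

/-- The quantity `[X]_g`: the largest Euclidean norm of a column of `X`. -/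
noncomputable def normG {m n : ℕ} (X : Matrix (Fin m) (Fin n) ℝ) : ℝ :=
  ⨆ j : Fin n, Real.sqrt (∑ i, X i j ^ 2)

/-- The smallest singular value of a matrix with `n` columns, that is, the `n`-th one in
decreasing order (Mathlib numbers the singular values from `0`). -/
noncomputable def sigmaMin {m n : ℕ} (X : Matrix (Fin m) (Fin n) ℝ) : ℝ :=
  (Matrix.toEuclideanLin X).singularValues (n - 1)

/-- The condition number `κ₂(X) = ‖X‖₂ / σ_min(X)` (meaningful when `X` has full column rank). -/
noncomputable def kappa2 {m n : ℕ} (X : Matrix (Fin m) (Fin n) ℝ) : ℝ :=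
  norm2 X / sigmaMin X

/-- The ratio `p = [X]_g / ‖X‖₂`. -/
noncomputable def ratioP {m n : ℕ} (X : Matrix (Fin m) (Fin n) ℝ) : ℝ :=
  normG X / norm2 X

/-- The largest absolute value `c` of an entry of `X`. -/
noncomputable def maxAbs {m n : ℕ} (X : Matrix (Fin m) (Fin n) ℝ) : ℝ :=
  ⨆ ij : Fin m × Fin n, |X ij.1 ij.2|

/-! ### The model of sparse matrices -/

/-- The number of nonzero entries in column `j`. -/
noncomputable def nnzCol {m n : ℕ} (X : Matrix (Fin m) (Fin n) ℝ) (j : Fin n) : ℕ :=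
  Set.ncard {i : Fin m | X i j ≠ 0}

/-- `X` is a sparse matrix with `v` dense columns, each with at most `t₁` nonzero entries, while
each of the remaining columns has at most `t₂` nonzero entries. -/
def IsSparse {m n : ℕ} (X : Matrix (Fin m) (Fin n) ℝ) (v t₁ t₂ : ℕ) : Prop :=
  v < n ∧ 0 < t₂ ∧ t₂ < t₁ ∧ t₁ ≤ m ∧
    ∃ D : Finset (Fin n), D.card = v ∧
      (∀ j ∈ D, nnzCol X j ≤ t₁) ∧ (∀ j ∉ D, nnzCol X j ≤ t₂)

/-- A `T₂` matrix is a sparse matrix without dense columns. -/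
def IsT2 {m n : ℕ} (X : Matrix (Fin m) (Fin n) ℝ) (t₁ t₂ : ℕ) : Prop :=
  IsSparse X 0 t₁ t₂

/-! ### Machine precision and the shift -/

/-- The machine precision (unit roundoff) of double precision. -/
noncomputable def machEps : ℝ := 2 ^ (-53 : ℤ)

/-- The alternative shift `j_s` of a sparse matrix. -/
noncomputable def shiftJs {m n : ℕ} (X : Matrix (Fin m) (Fin n) ℝ) (v t₁ t₂ : ℕ) : ℝ :=
  min
    (11 * (m * machEps + (n + 1) * machEps) * ((v * t₁ + n * t₂) * maxAbs X ^ 2))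
    (11 * (m * n * machEps + n * (n + 1) * machEps) * normG X ^ 2)

/-! ### Floating-point arithmetic -/

/-- A floating-point arithmetic that obeys the standard model with unit roundoff `u`: each
elementary operation returns the exact result up to a relative error of at most `u`. -/
structure FlArith (u : ℝ) where
  add : ℝ → ℝ → ℝ
  sub : ℝ → ℝ → ℝ
  mul : ℝ → ℝ → ℝ
  div : ℝ → ℝ → ℝ
  sqrt : ℝ → ℝ
  add_err : ∀ x y, |add x y - (x + y)| ≤ u * |x + y|
  sub_err : ∀ x y, |sub x y - (x - y)| ≤ u * |x - y|
  mul_err : ∀ x y, |mul x y - x * y| ≤ u * |x * y|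
  div_err : ∀ x y, y ≠ 0 → |div x y - x / y| ≤ u * |x / y|
  sqrt_err : ∀ x, 0 ≤ x → |sqrt x - Real.sqrt x| ≤ u * Real.sqrt x

section Algorithms

variable {u : ℝ} (fl : FlArith u)

/-- Recursive summation, from left to right. -/
def flSum : List ℝ → ℝ
  | [] => 0
  | a :: l => l.foldl fl.add a

/-- The computed inner product of two vectors. -/
def flDot {k : ℕ} (x y : Fin k → ℝ) : ℝ :=
  flSum fl ((List.finRange k).map fun i => fl.mul (x i) (y i))

/-- The computed product of two matrices. -/
def flMatMul {l k n : ℕ} (A : Matrix (Fin l) (Fin k) ℝ) (B : Matrix (Fin k) (Fin n) ℝ) :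
    Matrix (Fin l) (Fin n) ℝ :=
  fun i j => flDot fl (fun t => A i t) (fun t => B t j)

/-- The computed value of `b - ∑ i < j, x i * y i`, subtracting one product after the other. -/
def flSubDot {n : ℕ} (b : ℝ) (x y : Fin n → ℝ) (j : Fin n) : ℝ :=
  ((List.finRange n).filter (fun i => i < j)).foldl
    (fun acc i => fl.sub acc (fl.mul (x i) (y i))) b

/-- Step `k` of Cholesky factorization: row `k` of `R` is computed from the upper triangle of `A`
and from the rows of `R` above it. The step breaks down if the computed pivot is not positive. -/
noncomputable def flCholeskyStep {n : ℕ} (A : Matrix (Fin n) (Fin n) ℝ)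
    (R : Matrix (Fin n) (Fin n) ℝ) (k : Fin n) : Option (Matrix (Fin n) (Fin n) ℝ) :=
  let w := flSubDot fl (A k k) (fun i => R i k) (fun i => R i k) k
  if 0 < w then
    some (fun i j =>
      if i = k then
        if j < k then 0
        else if j = k then fl.sqrt w
        else fl.div (flSubDot fl (A k j) (fun i => R i k) (fun i => R i j) k) (fl.sqrt w)
      else R i j)
  else none

/-- Floating-point Cholesky factorization `A ≈ Rᵀ R` with `R` upper triangular;
the result is `none` if the factorization breaks down. -/
noncomputable def flCholesky {n : ℕ} (A : Matrix (Fin n) (Fin n) ℝ) :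
    Option (Matrix (Fin n) (Fin n) ℝ) :=
  (List.finRange n).foldlM (fun R k => flCholeskyStep fl A R k) 0

/-- The solution of `xᵀ R = bᵀ`, `R` upper triangular, computed by substitution. -/
def flSolveRow {n : ℕ} (R : Matrix (Fin n) (Fin n) ℝ) (b : Fin n → ℝ) : Fin n → ℝ :=
  (List.finRange n).foldl
    (fun x j => Function.update x j
      (fl.div (flSubDot fl (b j) x (fun i => R i j) j) (R j j))) 0

/-- The computed `X R⁻¹`, row by row. -/
def flSolve {m n : ℕ} (X : Matrix (Fin m) (Fin n) ℝ) (R : Matrix (Fin n) (Fin n) ℝ) :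
    Matrix (Fin m) (Fin n) ℝ :=
  fun i => flSolveRow fl R (fun j => X i j)

/-- The computed `G + s I`. -/
def flShift {n : ℕ} (G : Matrix (Fin n) (Fin n) ℝ) (s : ℝ) : Matrix (Fin n) (Fin n) ℝ :=
  fun i j => if i = j then fl.add (G i j) s else G i j

/-- Floating-point CholeskyQR: `G = Xᵀ X`, `R = Cholesky(G)`, `Q = X R⁻¹`. -/
noncomputable def flCholeskyQR {m n : ℕ} (X : Matrix (Fin m) (Fin n) ℝ) :
    Option (Matrix (Fin m) (Fin n) ℝ × Matrix (Fin n) (Fin n) ℝ) :=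
  (flCholesky fl (flMatMul fl X.transpose X)).map fun R => (flSolve fl X R, R)

/-- Floating-point Shifted CholeskyQR: `G = Xᵀ X`, `R = Cholesky(G + s I)`, `Q = X R⁻¹`. -/
noncomputable def flSCholeskyQR {m n : ℕ} (s : ℝ) (X : Matrix (Fin m) (Fin n) ℝ) :
    Option (Matrix (Fin m) (Fin n) ℝ × Matrix (Fin n) (Fin n) ℝ) :=
  (flCholesky fl (flShift fl (flMatMul fl X.transpose X) s)).map fun R => (flSolve fl X R, R)

/-- Floating-point CholeskyQR2: `[W,Y] = CholeskyQR(X)`, `[Q,Z] = CholeskyQR(W)`, `R = Z Y`. -/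
noncomputable def flCholeskyQR2 {m n : ℕ} (X : Matrix (Fin m) (Fin n) ℝ) :
    Option (Matrix (Fin m) (Fin n) ℝ × Matrix (Fin n) (Fin n) ℝ) :=
  (flCholeskyQR fl X).bind fun WY =>
    (flCholeskyQR fl WY.1).map fun QZ => (QZ.1, flMatMul fl QZ.2 WY.2)

/-- Floating-point Shifted CholeskyQR3 with shift `s`:
`[W,Y] = SCholeskyQR(X)`, `[Q,Z] = CholeskyQR2(W)`, `R = Z Y`.
The result is `none` if one of the three Cholesky factorizations breaks down. -/
noncomputable def flSCholeskyQR3 {m n : ℕ} (s : ℝ) (X : Matrix (Fin m) (Fin n) ℝ) :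
    Option (Matrix (Fin m) (Fin n) ℝ × Matrix (Fin n) (Fin n) ℝ) :=
  (flSCholeskyQR fl s X).bind fun WY =>
    (flCholeskyQR2 fl WY.1).map fun QZ => (QZ.1, flMatMul fl QZ.2 WY.2)

end Algorithms

end SparseCholeskyQR

open SparseCholeskyQR

namespace SparseCholeskyQR
open Matrix

section Norms

variable {k l m n : ℕ}

theorem normF_nonneg (A : Matrix (Fin m) (Fin n) ℝ) : 0 ≤ normF A := Real.sqrt_nonneg _

theorem normF_sq (A : Matrix (Fin m) (Fin n) ℝ) : normF A ^ 2 = ∑ i, ∑ j, A i j ^ 2 :=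
  Real.sq_sqrt (Finset.sum_nonneg fun _ _ => Finset.sum_nonneg fun _ _ => sq_nonneg _)

theorem normF_le_of_sq_le {A : Matrix (Fin m) (Fin n) ℝ} {c : ℝ} (hc : 0 ≤ c)
    (h : ∑ i, ∑ j, A i j ^ 2 ≤ c ^ 2) : normF A ≤ c :=
  Real.sqrt_le_iff.2 ⟨hc, h⟩

theorem normF_le_of_abs_le {A B : Matrix (Fin m) (Fin n) ℝ} (h : ∀ i j, |A i j| ≤ B i j) :
    normF A ≤ normF B :=
  Real.sqrt_le_sqrt (Finset.sum_le_sum fun i _ => Finset.sum_le_sum fun j _ => by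
    rw [← sq_abs]; exact pow_le_pow_left₀ (abs_nonneg _) (h i j) 2)

theorem normF_abs (A : Matrix (Fin m) (Fin n) ℝ) : normF (A.map abs) = normF A := by
  simp [normF]

section Frobenius

attribute [local instance] Matrix.frobeniusNormedAddCommGroup Matrix.frobeniusNormedSpace

theorem normF_eq_norm (A : Matrix (Fin m) (Fin n) ℝ) : normF A = ‖A‖ := by
  rw [Matrix.frobenius_norm_def, normF, Real.sqrt_eq_rpow]
  simp

theorem normF_add_le (A B : Matrix (Fin m) (Fin n) ℝ) : normF (A + B) ≤ normF A + normF B := by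
  simpa only [normF_eq_norm] using norm_add_le A B

theorem normF_neg (A : Matrix (Fin m) (Fin n) ℝ) : normF (-A) = normF A := by
  simp [normF]

theorem normF_smul (c : ℝ) (A : Matrix (Fin m) (Fin n) ℝ) : normF (c • A) = |c| * normF A := by
  simpa only [normF_eq_norm, Real.norm_eq_abs] using norm_smul c A

theorem normF_mul_le (A : Matrix (Fin l) (Fin m) ℝ) (B : Matrix (Fin m) (Fin n) ℝ) :
    normF (A * B) ≤ normF A * normF B := by
  simpa only [normF_eq_norm] using Matrix.frobenius_norm_mul A B

theorem normF_transpose (A : Matrix (Fin m) (Fin n) ℝ) : normF Aᵀ = normF A := by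
  simpa only [normF_eq_norm] using Matrix.frobenius_norm_transpose A

end Frobenius

/-- A matrix dominated entrywise by `c |A| |B|`. -/
theorem normF_le_of_abs_le_mul {E : Matrix (Fin l) (Fin n) ℝ} {A : Matrix (Fin l) (Fin m) ℝ}
    {B : Matrix (Fin m) (Fin n) ℝ} {c : ℝ} (hc : 0 ≤ c)
    (h : ∀ i j, |E i j| ≤ c * ∑ t, |A i t| * |B t j|) :
    normF E ≤ c * (normF A * normF B) := by
  calc normF E ≤ normF (c • (A.map abs * B.map abs)) :=
        normF_le_of_abs_le fun i j => by simpa [Matrix.mul_apply] using h i j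
    _ = c * normF (A.map abs * B.map abs) := by rw [normF_smul, abs_of_nonneg hc]
    _ ≤ c * (normF A * normF B) := by
        gcongr
        simpa only [normF_abs] using normF_mul_le (A.map abs) (B.map abs)

theorem dotProduct_self_nonneg (z : Fin n → ℝ) : 0 ≤ z ⬝ᵥ z :=
  Finset.sum_nonneg fun _ _ => mul_self_nonneg _

theorem norm2_nonneg (A : Matrix (Fin m) (Fin n) ℝ) : 0 ≤ norm2 A := norm_nonneg _

theorem norm_toLp_sq (z : Fin n → ℝ) : ‖WithLp.toLp 2 z‖ ^ 2 = z ⬝ᵥ z := by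
  rw [EuclideanSpace.norm_sq_eq]
  simp [dotProduct, sq]

theorem norm2_le_of_sq_le {A : Matrix (Fin m) (Fin n) ℝ} {c : ℝ} (hc : 0 ≤ c)
    (h : ∀ z, (A *ᵥ z) ⬝ᵥ (A *ᵥ z) ≤ c ^ 2 * (z ⬝ᵥ z)) : norm2 A ≤ c := by
  refine ContinuousLinearMap.opNorm_le_bound _ hc fun x => ?_
  have := h x.ofLp
  rw [← norm_toLp_sq, ← norm_toLp_sq, ← mul_pow] at this
  exact le_of_sq_le_sq this (by positivity)

theorem mulVec_sq_le (A : Matrix (Fin m) (Fin n) ℝ) (z : Fin n → ℝ) :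
    (A *ᵥ z) ⬝ᵥ (A *ᵥ z) ≤ norm2 A ^ 2 * (z ⬝ᵥ z) := by
  have := (Matrix.toEuclideanLin A).toContinuousLinearMap.le_opNorm (WithLp.toLp 2 z)
  rw [← norm_toLp_sq, ← norm_toLp_sq, ← mul_pow]
  exact pow_le_pow_left₀ (norm_nonneg _) this 2

theorem mulVec_sq_le_of_norm2_le {A : Matrix (Fin m) (Fin n) ℝ} {c : ℝ} (h : norm2 A ≤ c)
    (z : Fin n → ℝ) : (A *ᵥ z) ⬝ᵥ (A *ᵥ z) ≤ c ^ 2 * (z ⬝ᵥ z) :=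
  (mulVec_sq_le A z).trans (mul_le_mul_of_nonneg_right
    (pow_le_pow_left₀ (norm2_nonneg A) h 2) (dotProduct_self_nonneg z))

section Operator

open scoped Matrix.Norms.L2Operator

theorem norm2_eq_norm (A : Matrix (Fin m) (Fin n) ℝ) : norm2 A = ‖A‖ :=
  (Matrix.l2_opNorm_def A).symm

theorem norm2_add_le (A B : Matrix (Fin m) (Fin n) ℝ) : norm2 (A + B) ≤ norm2 A + norm2 B := by
  simpa only [norm2_eq_norm] using norm_add_le A B

theorem norm2_mul_le (A : Matrix (Fin l) (Fin m) ℝ) (B : Matrix (Fin m) (Fin n) ℝ) :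
    norm2 (A * B) ≤ norm2 A * norm2 B := by
  simpa only [norm2_eq_norm] using Matrix.l2_opNorm_mul A B

theorem norm2_transpose (A : Matrix (Fin m) (Fin n) ℝ) : norm2 Aᵀ = norm2 A := by
  have := Matrix.l2_opNorm_conjTranspose A
  rwa [Matrix.conjTranspose_eq_transpose_of_trivial, ← norm2_eq_norm, ← norm2_eq_norm] at this

end Operator

theorem sum_col_sq (A : Matrix (Fin m) (Fin n) ℝ) (j : Fin n) :
    ∑ i, A i j ^ 2 = (A *ᵥ Pi.single j 1) ⬝ᵥ (A *ᵥ Pi.single j 1) := by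
  simp [dotProduct, sq, Matrix.col_apply]

theorem sum_col_sq_le (A : Matrix (Fin m) (Fin n) ℝ) (j : Fin n) :
    ∑ i, A i j ^ 2 ≤ norm2 A ^ 2 := by
  rw [sum_col_sq]
  simpa using mulVec_sq_le A (Pi.single j 1)

theorem normF_mul_le_norm2_mul (A : Matrix (Fin l) (Fin m) ℝ) (B : Matrix (Fin m) (Fin n) ℝ) :
    normF (A * B) ≤ norm2 A * normF B := by
  refine normF_le_of_sq_le (mul_nonneg (norm2_nonneg _) (normF_nonneg _)) ?_
  rw [mul_pow, normF_sq, Finset.sum_comm, Finset.sum_comm (f := fun i j => B i j ^ 2),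
    Finset.mul_sum]
  refine Finset.sum_le_sum fun j _ => ?_
  have := mulVec_sq_le A (fun t => B t j)
  simpa [dotProduct, sq, Matrix.mul_apply, mulVec] using this

theorem normF_mul_le_mul_norm2 (A : Matrix (Fin l) (Fin m) ℝ) (B : Matrix (Fin m) (Fin n) ℝ) :
    normF (A * B) ≤ normF A * norm2 B := by
  have := normF_mul_le_norm2_mul Bᵀ Aᵀ
  rwa [← Matrix.transpose_mul, normF_transpose, normF_transpose, norm2_transpose,
    mul_comm] at this

theorem norm2_le_normF (A : Matrix (Fin m) (Fin n) ℝ) : norm2 A ≤ normF A := by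
  refine norm2_le_of_sq_le (normF_nonneg _) fun z => ?_
  rw [normF_sq, Finset.sum_mul]
  refine Finset.sum_le_sum fun i _ => ?_
  have := Finset.sum_mul_sq_le_sq_mul_sq Finset.univ (fun j => A i j) z
  simpa [dotProduct, sq, mulVec] using this

theorem normF_sq_le_of_col_le {A : Matrix (Fin m) (Fin n) ℝ} {c : ℝ}
    (h : ∀ j, ∑ i, A i j ^ 2 ≤ c) : normF A ^ 2 ≤ n * c := by
  rw [normF_sq, Finset.sum_comm]
  simpa using Finset.sum_le_sum fun j (_ : j ∈ Finset.univ) => h j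

theorem normF_sq_le_card_mul_norm2_sq (A : Matrix (Fin m) (Fin n) ℝ) :
    normF A ^ 2 ≤ n * norm2 A ^ 2 :=
  normF_sq_le_of_col_le (sum_col_sq_le A)

theorem normF_le_sqrt_mul_norm2 (A : Matrix (Fin m) (Fin n) ℝ) :
    normF A ≤ Real.sqrt n * norm2 A := by
  refine le_of_sq_le_sq ?_ (mul_nonneg (Real.sqrt_nonneg _) (norm2_nonneg _))
  rw [mul_pow, Real.sq_sqrt (Nat.cast_nonneg _)]
  exact normF_sq_le_card_mul_norm2_sq A

theorem sum_col_sq_le_normG_sq (A : Matrix (Fin m) (Fin n) ℝ) (j : Fin n) :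
    ∑ i, A i j ^ 2 ≤ normG A ^ 2 := by
  have : Real.sqrt (∑ i, A i j ^ 2) ≤ normG A :=
    le_ciSup (f := fun j => Real.sqrt (∑ i, A i j ^ 2)) (Set.finite_range _).bddAbove j
  exact (Real.sqrt_le_left ((Real.sqrt_nonneg _).trans this)).1 this

theorem normG_nonneg (A : Matrix (Fin m) (Fin n) ℝ) : 0 ≤ normG A :=
  Real.iSup_nonneg fun _ => Real.sqrt_nonneg _

theorem normG_le {A : Matrix (Fin m) (Fin n) ℝ} {c : ℝ} (hc : 0 ≤ c)
    (h : ∀ j, ∑ i, A i j ^ 2 ≤ c ^ 2) : normG A ≤ c :=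
  Real.iSup_le (fun j => Real.sqrt_le_iff.2 ⟨hc, h j⟩) hc

theorem normG_le_norm2 (A : Matrix (Fin m) (Fin n) ℝ) : normG A ≤ norm2 A :=
  normG_le (norm2_nonneg A) (sum_col_sq_le A)

theorem normF_sq_le_card_mul_normG_sq (A : Matrix (Fin m) (Fin n) ℝ) :
    normF A ^ 2 ≤ n * normG A ^ 2 :=
  normF_sq_le_of_col_le (sum_col_sq_le_normG_sq A)

theorem norm2_le_sqrt_mul_normG (A : Matrix (Fin m) (Fin n) ℝ) :
    norm2 A ≤ Real.sqrt n * normG A := by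
  refine (norm2_le_normF A).trans
    (le_of_sq_le_sq ?_ (mul_nonneg (Real.sqrt_nonneg _) (normG_nonneg _)))
  rw [mul_pow, Real.sq_sqrt (Nat.cast_nonneg _)]
  exact normF_sq_le_card_mul_normG_sq A

theorem abs_dotProduct_mulVec_le (E : Matrix (Fin n) (Fin n) ℝ) (z : Fin n → ℝ) :
    |z ⬝ᵥ (E *ᵥ z)| ≤ norm2 E * (z ⬝ᵥ z) := by
  refine abs_le_of_sq_le_sq ?_ (mul_nonneg (norm2_nonneg _) (dotProduct_self_nonneg _))
  have h1 := Finset.sum_mul_sq_le_sq_mul_sq Finset.univ z (E *ᵥ z)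
  have h2 := mulVec_sq_le E z
  have h3 := dotProduct_self_nonneg z
  have h4 : (∑ i, z i ^ 2) = z ⬝ᵥ z := by simp [dotProduct, sq]
  have h5 : (∑ i, (E *ᵥ z) i ^ 2) = (E *ᵥ z) ⬝ᵥ (E *ᵥ z) := by simp [dotProduct, sq]
  rw [h4, h5] at h1
  change (z ⬝ᵥ E *ᵥ z) ^ 2 ≤ _ at h1
  nlinarith [mul_le_mul_of_nonneg_left h2 h3]

theorem mulVec_dotProduct_mulVec (A : Matrix (Fin m) (Fin n) ℝ) (z : Fin n → ℝ) :
    (A *ᵥ z) ⬝ᵥ (A *ᵥ z) = z ⬝ᵥ ((Aᵀ * A) *ᵥ z) := by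
  rw [← Matrix.mulVec_mulVec, Matrix.dotProduct_mulVec z, Matrix.vecMul_transpose]

theorem norm2_inv_le {R : Matrix (Fin n) (Fin n) ℝ} {r : ℝ} (hr : 0 < r) (hR : IsUnit R.det)
    (h : ∀ z, r ^ 2 * (z ⬝ᵥ z) ≤ (R *ᵥ z) ⬝ᵥ (R *ᵥ z)) : norm2 R⁻¹ ≤ r⁻¹ := by
  refine norm2_le_of_sq_le (inv_nonneg.2 hr.le) fun z => ?_
  have := h (R⁻¹ *ᵥ z)
  rw [Matrix.mulVec_mulVec, Matrix.mul_nonsing_inv _ hR, Matrix.one_mulVec] at this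
  rw [inv_pow, inv_mul_eq_div, le_div_iff₀ (by positivity)]
  linarith

/-- The smallest singular value is a lower bound for the stretching of vectors. -/
theorem sigmaMin_sq_mul_le (X : Matrix (Fin m) (Fin n) ℝ) (z : Fin n → ℝ) :
    sigmaMin X ^ 2 * (z ⬝ᵥ z) ≤ (X *ᵥ z) ⬝ᵥ (X *ᵥ z) := by
  rcases Nat.eq_zero_or_pos n with rfl | hn
  · simp [dotProduct, Matrix.mulVec]
  set T := Matrix.toEuclideanLin X
  have hd : Module.finrank ℝ (EuclideanSpace ℝ (Fin n)) = n := by simp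
  set x : EuclideanSpace ℝ (Fin n) := WithLp.toLp 2 z
  set b := T.isSymmetric_adjoint_comp_self.eigenvectorBasis hd
  have hTx : (X *ᵥ z) ⬝ᵥ (X *ᵥ z) = inner ℝ x ((LinearMap.adjoint T ∘ₗ T) x) := by
    rw [LinearMap.comp_apply, LinearMap.adjoint_inner_right, real_inner_self_eq_norm_sq,
      ← norm_toLp_sq]
    rfl
  rw [hTx, ← norm_toLp_sq, ← real_inner_self_eq_norm_sq,
    ← b.sum_inner_mul_inner x x, ← b.sum_inner_mul_inner x, Finset.mul_sum]
  refine Finset.sum_le_sum fun i _ => ?_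
  have h1 : inner ℝ (b i) ((LinearMap.adjoint T ∘ₗ T) x) =
      T.singularValues i ^ 2 * inner ℝ (b i) x := by
    rw [← T.isSymmetric_adjoint_comp_self (b i) x,
      T.isSymmetric_adjoint_comp_self.apply_eigenvectorBasis, inner_smul_left,
      T.sq_singularValues_fin hd i]
    rfl
  have h2 : sigmaMin X ≤ T.singularValues i := T.singularValues_antitone (by omega)
  have h3 : sigmaMin X ^ 2 ≤ T.singularValues i ^ 2 :=
    pow_le_pow_left₀ (T.singularValues_nonneg _) h2 2
  rw [h1, real_inner_comm]
  nlinarith [mul_le_mul_of_nonneg_right h3 (mul_self_nonneg (inner ℝ (b i) x))]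

theorem sigmaMin_pos {X : Matrix (Fin m) (Fin n) ℝ} (hn : 0 < n) (h : X.rank = n) :
    0 < sigmaMin X := by
  rw [sigmaMin, LinearMap.singularValues_pos_iff_lt_finrank_range]
  have : Module.finrank ℝ (LinearMap.range (Matrix.toEuclideanLin X)) = n := by
    have h' := Matrix.rank_eq_finrank_range_toLin X (EuclideanSpace.basisFun (Fin m) ℝ).toBasis
      (EuclideanSpace.basisFun (Fin n) ℝ).toBasis
    rw [← Matrix.toEuclideanLin_eq_toLin_orthonormal] at h'
    exact h'.symm.trans h
  omega

end Norms


section Rounding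

/-- The bound `(1 - u)⁻ᵏ - 1` for the relative error accumulated in `k` operations. -/
noncomputable def roundErr (u : ℝ) (k : ℕ) : ℝ := ((1 - u) ^ k)⁻¹ - 1

variable {u : ℝ}

theorem roundErr_succ (h1 : u < 1) (k : ℕ) :
    roundErr u (k + 1) = (roundErr u k + u) / (1 - u) := by
  have : 1 - u ≠ 0 := by linarith
  unfold roundErr
  field_simp
  ring

theorem roundErr_nonneg (h0 : 0 ≤ u) (h1 : u < 1) (k : ℕ) : 0 ≤ roundErr u k := by
  have : 1 ≤ ((1 - u) ^ k)⁻¹ :=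
    (one_le_inv₀ (pow_pos (by linarith) k)).2 (pow_le_one₀ (by linarith) (by linarith))
  unfold roundErr
  linarith

theorem roundErr_mono (h0 : 0 ≤ u) (h1 : u < 1) {k l : ℕ} (h : k ≤ l) :
    roundErr u k ≤ roundErr u l :=
  sub_le_sub_right (inv_anti₀ (pow_pos (by linarith) l)
    (pow_le_pow_of_le_one (by linarith) (by linarith) h)) 1

theorem roundErr_le (h1 : u < 1) {k : ℕ} (hk : k * u < 1) :
    roundErr u k ≤ k * u / (1 - k * u) := by
  have h : 1 - k * u ≤ (1 - u) ^ k := by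
    have := one_add_mul_le_pow (a := -u) (by linarith) k
    calc 1 - k * u = 1 + k * -u := by ring
      _ ≤ _ := this
      _ = _ := by ring
  have hp : 0 < 1 - k * u := by linarith
  calc roundErr u k ≤ (1 - k * u)⁻¹ - 1 := sub_le_sub_right (inv_anti₀ hp h) 1
    _ = _ := by field_simp; ring

theorem le_roundErr_succ (h0 : 0 ≤ u) (h1 : u < 1) (k : ℕ) : u ≤ roundErr u (k + 1) := by
  have hp : 0 < 1 - u := by linarith
  rw [roundErr_succ h1, le_div_iff₀ hp]
  nlinarith [roundErr_nonneg h0 h1 k]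

theorem one_add_mul_roundErr_le (h0 : 0 ≤ u) (h1 : u < 1) (k : ℕ) :
    roundErr u k * (1 + u) + u ≤ roundErr u (k + 1) := by
  have hp : 0 < 1 - u := by linarith
  have hr := roundErr_nonneg h0 h1 k
  rw [roundErr_succ h1, le_div_iff₀ hp]
  nlinarith [mul_nonneg hr (mul_nonneg h0 h0), mul_nonneg h0 h0]

theorem exists_rel_err (h0 : 0 ≤ u) {a b : ℝ} (h : |a - b| ≤ u * |b|) : ∃ δ, |δ| ≤ u ∧ a = b * (1 + δ) := by
  rcases eq_or_ne b 0 with rfl | hb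
  · refine ⟨u, ?_, by simpa using h⟩
    exact (abs_of_nonneg h0).le
  · refine ⟨(a - b) / b, ?_, by field_simp; ring⟩
    rwa [abs_div, div_le_iff₀ (abs_pos.2 hb)]

theorem roundErr_div_step (h0 : 0 ≤ u) (h1 : u < 1) {k : ℕ} {c δ : ℝ} (hc : 0 < c)
    (hck : |c - 1| ≤ roundErr u k) (hδ : |δ| ≤ u) :
    0 < c / (1 + δ) ∧ |c / (1 + δ) - 1| ≤ roundErr u (k + 1) := by
  have hδ' := abs_le.1 hδ
  have hp : 0 < 1 + δ := by linarith
  refine ⟨div_pos hc hp, ?_⟩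
  have : c / (1 + δ) - 1 = (c - 1 - δ) / (1 + δ) := by field_simp; ring
  rw [this, abs_div, abs_of_pos hp, roundErr_succ h1]
  have : |c - 1 - δ| ≤ roundErr u k + u := (abs_sub _ _).trans (add_le_add hck hδ)
  exact div_le_div₀ (add_nonneg (roundErr_nonneg h0 h1 k) h0) this (by linarith) (by linarith)

variable (fl : FlArith u)

theorem foldl_add_err (h0 : 0 ≤ u) (h1 : u < 1) {ι : Type*} (x y : ι → ℝ) (l : List ι)
    (a s t : ℝ) (k : ℕ) (hs : |a - s| ≤ roundErr u (k + 1) * t) (hst : |s| ≤ t) :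
    |(l.map fun i => fl.mul (x i) (y i)).foldl fl.add a - (s + (l.map fun i => x i * y i).sum)| ≤
      roundErr u (k + 1 + l.length) * (t + (l.map fun i => |x i * y i|).sum) := by
  induction l generalizing a s t k with
  | nil => simpa using hs
  | cons i l ih =>
    have hr := roundErr_nonneg h0 h1 (k + 1)
    have hmul := fl.mul_err (x i) (y i)
    have hadd := fl.add_err a (fl.mul (x i) (y i))
    have ht : 0 ≤ t := (abs_nonneg s).trans hst
    have hstep := one_add_mul_roundErr_le h0 h1 (k + 1)
    have hu := le_roundErr_succ h0 h1 k
    have key : |fl.add a (fl.mul (x i) (y i)) - (s + x i * y i)| ≤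
        roundErr u (k + 1 + 1) * (t + |x i * y i|) := by
      set p := x i * y i
      set q := fl.mul (x i) (y i)
      have e1 : |fl.add a q - (s + p)| ≤ |fl.add a q - (a + q)| + (|a - s| + |q - p|) := by
        calc |fl.add a q - (s + p)| = |(fl.add a q - (a + q)) + ((a - s) + (q - p))| := by ring_nf
          _ ≤ _ := (abs_add_le _ _).trans (add_le_add_right (abs_add_le _ _) _)
      have e2 : |a + q| ≤ (|a - s| + |q - p|) + (|s| + |p|) := by
        calc |a + q| = |((a - s) + (q - p)) + (s + p)| := by ring_nf
          _ ≤ _ := (abs_add_le _ _).trans (add_le_add (abs_add_le _ _) (abs_add_le _ _))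
      have e3 : |a - s| + |q - p| ≤ roundErr u (k + 1) * (t + |p|) := by
        nlinarith [abs_nonneg p, mul_le_mul_of_nonneg_right hu (abs_nonneg p)]
      have e4 : u * |a + q| ≤ u * (roundErr u (k + 1) * (t + |p|) + (t + |p|)) :=
        mul_le_mul_of_nonneg_left (e2.trans (add_le_add e3 (by linarith))) h0
      have e5 := mul_le_mul_of_nonneg_right hstep (add_nonneg ht (abs_nonneg p))
      linarith
    have := ih (fl.add a (fl.mul (x i) (y i))) (s + x i * y i) (t + |x i * y i|) (k + 1) key
      ((abs_add_le _ _).trans (add_le_add_left hst _))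
    simp only [List.map_cons, List.foldl_cons, List.sum_cons, List.length_cons]
    rw [show k + 1 + (l.length + 1) = k + 1 + 1 + l.length by ring, ← add_assoc, ← add_assoc]
    exact this

theorem sum_finRange_map {k : ℕ} (f : Fin k → ℝ) :
    ((List.finRange k).map f).sum = ∑ i, f i := by
  rw [← List.sum_toFinset _ (List.nodup_finRange k), List.toFinset_finRange]

theorem flDot_err (h0 : 0 ≤ u) (h1 : u < 1) {k : ℕ} (x y : Fin k → ℝ) :
    |flDot fl x y - ∑ i, x i * y i| ≤ roundErr u k * ∑ i, |x i| * |y i| := by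
  simp only [← abs_mul]
  rw [← sum_finRange_map, ← sum_finRange_map]
  unfold flDot
  have hlen : k = (List.finRange k).length := by simp
  generalize List.finRange k = l at hlen ⊢
  rw [congrArg (roundErr u) hlen]
  clear hlen
  cases l with
  | nil => simp [flSum]
  | cons i l =>
    have := foldl_add_err fl h0 h1 x y l (fl.mul (x i) (y i)) (x i * y i) |x i * y i| 0
      ((fl.mul_err _ _).trans (mul_le_mul_of_nonneg_right (le_roundErr_succ h0 h1 0)
        (abs_nonneg _))) le_rfl
    simp only [List.map_cons, flSum, List.sum_cons, List.length_cons]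
    rwa [show l.length + 1 = 0 + 1 + l.length by ring]

theorem flMatMul_err (h0 : 0 ≤ u) (h1 : u < 1) {l k n : ℕ} (A : Matrix (Fin l) (Fin k) ℝ)
    (B : Matrix (Fin k) (Fin n) ℝ) (i : Fin l) (j : Fin n) :
    |(flMatMul fl A B - A * B) i j| ≤ roundErr u k * ∑ t, |A i t| * |B t j| := by
  rw [Matrix.sub_apply, Matrix.mul_apply]
  exact flDot_err fl h0 h1 _ _

theorem normF_flMatMul_sub_le (h0 : 0 ≤ u) (h1 : u < 1) {l k n : ℕ}
    (A : Matrix (Fin l) (Fin k) ℝ) (B : Matrix (Fin k) (Fin n) ℝ) :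
    normF (flMatMul fl A B - A * B) ≤ roundErr u k * (normF A * normF B) :=
  normF_le_of_abs_le_mul (roundErr_nonneg h0 h1 k) (flMatMul_err fl h0 h1 A B)

theorem foldl_sub_err (h0 : 0 ≤ u) (h1 : u < 1) {ι : Type*} (x y : ι → ℝ) (l : List ι) (b : ℝ) :
    ∃ c, 0 < c ∧ |c - 1| ≤ roundErr u l.length ∧
      |b - l.foldl (fun acc i => fl.sub acc (fl.mul (x i) (y i))) b * c -
        (l.map fun i => x i * y i).sum| ≤
      roundErr u l.length * (l.map fun i => |x i * y i|).sum := by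
  induction l generalizing b with
  | nil => exact ⟨1, by simp [roundErr]⟩
  | cons i l ih =>
    obtain ⟨c, hc, hc1, hb⟩ := ih (fl.sub b (fl.mul (x i) (y i)))
    obtain ⟨δ, hδ, hm⟩ := exists_rel_err h0 (fl.mul_err (x i) (y i))
    obtain ⟨η, hη, hs⟩ := exists_rel_err h0 (fl.sub_err b (fl.mul (x i) (y i)))
    obtain ⟨hc', hc1'⟩ := roundErr_div_step h0 h1 hc hc1 hη
    refine ⟨c / (1 + η), hc', hc1', ?_⟩
    simp only [List.map_cons, List.foldl_cons, List.sum_cons, List.length_cons]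
    set w := l.foldl (fun acc i => fl.sub acc (fl.mul (x i) (y i)))
      (fl.sub b (fl.mul (x i) (y i)))
    set S := (l.map fun i => x i * y i).sum
    set T := (l.map fun i => |x i * y i|).sum
    set p := x i * y i
    have hη' := abs_le.1 hη
    have hp : 0 < 1 + η := by linarith
    have hST : |S| ≤ T := by
      have := List.le_sum_of_subadditive (fun a : ℝ => |a|) abs_zero.le abs_add_le
        (l.map fun i => x i * y i)
      rwa [List.map_map] at this
    have hT : 0 ≤ T := (abs_nonneg S).trans hST
    have hr := roundErr_nonneg h0 h1 l.length
    have e : b - w * (c / (1 + η)) - (p + S) =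
        (fl.sub b (fl.mul (x i) (y i)) - w * c - S - η * S) / (1 + η) + p * δ := by
      rw [hs, hm]
      field_simp
      ring
    have e1 : |fl.sub b (fl.mul (x i) (y i)) - w * c - S - η * S| ≤
        (roundErr u l.length + u) * T := by
      refine (abs_sub _ _).trans ?_
      rw [abs_mul, add_mul]
      exact add_le_add hb (mul_le_mul hη hST (abs_nonneg _) h0)
    have e2 : |fl.sub b (fl.mul (x i) (y i)) - w * c - S - η * S| / (1 + η) ≤
        roundErr u (l.length + 1) * T := by
      rw [roundErr_succ h1, div_mul_eq_mul_div]
      exact div_le_div₀ (mul_nonneg (add_nonneg hr h0) hT) e1 (by linarith) (by linarith)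
    rw [e]
    refine (abs_add_le _ _).trans ?_
    rw [abs_div, abs_of_pos hp, abs_mul]
    have e3 := mul_le_mul_of_nonneg_left (hδ.trans (le_roundErr_succ h0 h1 l.length))
      (abs_nonneg p)
    linarith

theorem flSubDot_err (h0 : 0 ≤ u) (h1 : u < 1) {n : ℕ} (b : ℝ) (x y : Fin n → ℝ) (j : Fin n) :
    ∃ c, 0 < c ∧ |c - 1| ≤ roundErr u j ∧
      |b - flSubDot fl b x y j * c - ∑ i ∈ Finset.Iio j, x i * y i| ≤
        roundErr u j * ∑ i ∈ Finset.Iio j, |x i| * |y i| := by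
  have hnd : ((List.finRange n).filter (fun i => i < j)).Nodup :=
    (List.nodup_finRange n).filter _
  have hfs : ((List.finRange n).filter (fun i => i < j)).toFinset = Finset.Iio j := by
    ext i; simp
  have hlen : ((List.finRange n).filter (fun i => i < j)).length = j := by
    rw [← List.toFinset_card_of_nodup hnd, hfs, Fin.card_Iio]
  have := foldl_sub_err fl h0 h1 x y ((List.finRange n).filter (fun i => i < j)) b
  rw [hlen, ← List.sum_toFinset _ hnd, ← List.sum_toFinset _ hnd, hfs] at this
  simp only [← abs_mul]
  exact this

theorem foldlM_finRange_induction {α : Type*} {n : ℕ} (P : ℕ → α → Prop)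
    (f : α → Fin n → Option α) (a : α) (h0 : P 0 a)
    (hs : ∀ (k : Fin n) b, P k b → ∃ b', f b k = some b' ∧ P (k + 1) b') :
    ∃ r, (List.finRange n).foldlM f a = some r ∧ P n r := by
  have H : ∀ k ≤ n, ∃ r, ((List.finRange n).take k).foldlM f a = some r ∧ P k r := by
    intro k
    induction k with
    | zero => exact fun _ => ⟨a, rfl, h0⟩
    | succ k ih =>
      intro hk
      obtain ⟨r, hr, hP⟩ := ih (by omega)
      obtain ⟨r', hr', hP'⟩ := hs ⟨k, hk⟩ r hP
      refine ⟨r', ?_, hP'⟩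
      rw [List.take_succ_eq_append_getElem (by simpa using hk), List.foldlM_append, hr]
      simpa using hr'
  obtain ⟨r, hr, hP⟩ := H n le_rfl
  exact ⟨r, by simpa [List.take_of_length_le] using hr, hP⟩

theorem foldl_finRange_induction {α : Type*} {n : ℕ} (P : ℕ → α → Prop)
    (f : α → Fin n → α) (a : α) (h0 : P 0 a)
    (hs : ∀ (k : Fin n) b, P k b → P (k + 1) (f b k)) :
    P n ((List.finRange n).foldl f a) := by
  obtain ⟨r, hr, hP⟩ := foldlM_finRange_induction P (fun b k => some (f b k)) a h0
    fun k b hb => ⟨_, rfl, hs k b hb⟩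
  have := List.foldlM_pure (m := Option) (f := f) (b := a) (l := List.finRange n)
  rw [show (fun b k => some (f b k)) = fun b k => (pure (f b k) : Option α) from rfl, this] at hr
  rwa [show (List.finRange n).foldl f a = r from Option.some_injective _ hr]

theorem sum_eq_sum_Iio_add {n : ℕ} (f : Fin n → ℝ) (k : Fin n) (h : ∀ i, k < i → f i = 0) :
    ∑ i, f i = ∑ i ∈ Finset.Iio k, f i + f k := by
  rw [add_comm, ← Finset.sum_insert (by simp), Finset.Iio_insert]
  refine (Finset.sum_subset (Finset.subset_univ _) fun i _ hi => h i ?_).symm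
  simpa using hi

/-- Replacing a coefficient close to `1` by `1` in a backward error bound. -/
theorem abs_sub_le_of_coeff {b d c S T φ : ℝ} (hc : |c - 1| ≤ φ)
    (h : |b - d * c - S| ≤ φ * T) : |S + d - b| ≤ φ * (T + |d|) := by
  have : S + d - b = -(b - d * c - S) - d * (c - 1) := by ring
  rw [this]
  refine (abs_sub _ _).trans ?_
  rw [abs_neg, abs_mul, mul_add, mul_comm φ |d|]
  exact add_le_add h (mul_le_mul_of_nonneg_left hc (abs_nonneg _))

theorem flSolveRow_err (h0 : 0 ≤ u) (h1 : u < 1) {n : ℕ} {R : Matrix (Fin n) (Fin n) ℝ}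
    (hR : ∀ i j, j < i → R i j = 0) (hd : ∀ i, R i i ≠ 0) (b : Fin n → ℝ) (j : Fin n) :
    |∑ l, flSolveRow fl R b l * R l j - b j| ≤
      roundErr u n * ∑ l, |flSolveRow fl R b l| * |R l j| := by
  have H := foldl_finRange_induction (fun (k : ℕ) (x : Fin n → ℝ) =>
      (∀ i : Fin n, k ≤ i → x i = 0) ∧ ∀ j : Fin n, (j : ℕ) < k →
        |∑ l, x l * R l j - b j| ≤ roundErr u n * ∑ l, |x l| * |R l j|)
    (fun x j => Function.update x j (fl.div (flSubDot fl (b j) x (fun i => R i j) j) (R j j))) 0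
    ⟨fun _ _ => rfl, fun _ h => absurd h (by omega)⟩ ?_
  · exact H.2 j j.2
  · clear j
    rintro k x ⟨hx0, hx⟩
    set v := fl.div (flSubDot fl (b k) x (fun i => R i k) k) (R k k) with hv
    refine ⟨fun i hi => ?_, fun j hj => ?_⟩
    · rw [Function.update_of_ne (by rintro rfl; omega)]
      exact hx0 i (by omega)
    · rcases lt_or_eq_of_le (Nat.lt_succ_iff.1 hj) with hjk | hjk
      · have hz : R k j = 0 := hR k j hjk
        have e : ∀ l, Function.update x k v l * R l j = x l * R l j := fun l => by
          rcases eq_or_ne l k with rfl | h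
          · simp [hz]
          · rw [Function.update_of_ne h]
        simp only [← abs_mul, e]
        simpa only [← abs_mul] using hx j hjk
      · obtain rfl : j = k := Fin.ext hjk
        have e : ∀ l ∈ Finset.Iio j, Function.update x j v l = x l := fun l hl =>
          Function.update_of_ne (Finset.mem_Iio.1 hl).ne _ _
        have e1 : ∑ l ∈ Finset.Iio j, Function.update x j v l * R l j =
            ∑ l ∈ Finset.Iio j, x l * R l j := Finset.sum_congr rfl fun l hl => by rw [e l hl]
        have e2 : ∑ l ∈ Finset.Iio j, |Function.update x j v l| * |R l j| =
            ∑ l ∈ Finset.Iio j, |x l| * |R l j| := Finset.sum_congr rfl fun l hl => by rw [e l hl]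
        rw [sum_eq_sum_Iio_add _ j fun i hi => by rw [hR i j hi, mul_zero],
          sum_eq_sum_Iio_add _ j fun i hi => by rw [hR i j hi, abs_zero, mul_zero],
          e1, e2, Function.update_self, ← abs_mul]
        obtain ⟨c, hc, hc1, hb⟩ := flSubDot_err fl h0 h1 (b j) x (fun i => R i j) j
        obtain ⟨δ, hδ, hdiv⟩ := exists_rel_err h0
          (fl.div_err (flSubDot fl (b j) x (fun i => R i j) j) _ (hd j))
        rw [← hv] at hdiv
        obtain ⟨-, hc1'⟩ := roundErr_div_step h0 h1 hc hc1 hδ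
        have hp : 1 + δ ≠ 0 := by have := abs_le.1 hδ; linarith
        have hw : flSubDot fl (b j) x (fun i => R i j) j * c = v * R j j * (c / (1 + δ)) := by
          have := hd j
          rw [hdiv]; field_simp
        rw [hw] at hb
        refine abs_sub_le_of_coeff (hc1'.trans (roundErr_mono h0 h1 j.2))
          (hb.trans (mul_le_mul_of_nonneg_right (roundErr_mono h0 h1 j.2.le) ?_))
        positivity

theorem normF_flSolve_mul_sub_le (h0 : 0 ≤ u) (h1 : u < 1) {m n : ℕ}
    {R : Matrix (Fin n) (Fin n) ℝ} (hR : ∀ i j, j < i → R i j = 0) (hd : ∀ i, R i i ≠ 0)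
    (X : Matrix (Fin m) (Fin n) ℝ) :
    normF (flSolve fl X R * R - X) ≤ roundErr u n * (normF (flSolve fl X R) * normF R) :=
  normF_le_of_abs_le_mul (roundErr_nonneg h0 h1 n) fun i j => by
    rw [Matrix.sub_apply, Matrix.mul_apply]
    exact flSolveRow_err fl h0 h1 hR hd _ j

end Rounding


section Cholesky

variable {u : ℝ} (fl : FlArith u) {n : ℕ}

/-- The symmetric matrix with the same upper triangle as `A`. -/
def symUpper (A : Matrix (Fin n) (Fin n) ℝ) : Matrix (Fin n) (Fin n) ℝ :=
  fun i j => if i ≤ j then A i j else A j i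

/-- The state of Cholesky factorization after `k` rows. -/
structure CholeskyRows (φ : ℝ) (A : Matrix (Fin n) (Fin n) ℝ) (k : ℕ)
    (R : Matrix (Fin n) (Fin n) ℝ) : Prop where
  row_eq_zero : ∀ i j : Fin n, k ≤ i → R i j = 0
  upper : ∀ i j : Fin n, j < i → R i j = 0
  diag_pos : ∀ i : Fin n, (i : ℕ) < k → 0 < R i i
  err : ∀ i j : Fin n, (i : ℕ) < k → i ≤ j →
    |∑ l, R l i * R l j - A i j| ≤ φ * ∑ l, |R l i| * |R l j|

theorem CholeskyRows.step (h0 : 0 ≤ u) (h1 : u < 1) {A R : Matrix (Fin n) (Fin n) ℝ} {k : Fin n}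
    (h : CholeskyRows (roundErr u (n + 1)) A k R)
    (hw : 0 < flSubDot fl (A k k) (fun i => R i k) (fun i => R i k) k) :
    ∃ R', flCholeskyStep fl A R k = some R' ∧ CholeskyRows (roundErr u (n + 1)) A (k + 1) R' := by
  set w := flSubDot fl (A k k) (fun i => R i k) (fun i => R i k) k with hwdef
  set R' : Matrix (Fin n) (Fin n) ℝ := fun i j =>
    if i = k then
      if j < k then 0
      else if j = k then fl.sqrt w
      else fl.div (flSubDot fl (A k j) (fun i => R i k) (fun i => R i j) k) (fl.sqrt w)
    else R i j with hR'
  have hstep : flCholeskyStep fl A R k = some R' := by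
    unfold flCholeskyStep
    exact if_pos hw
  obtain ⟨δ, hδ, hsqrt⟩ := exists_rel_err (a := fl.sqrt w) (b := Real.sqrt w) h0
    (by simpa only [abs_of_nonneg (Real.sqrt_nonneg w)] using fl.sqrt_err w hw.le)
  have hδ' := abs_le.1 hδ
  have hp : 0 < 1 + δ := by linarith
  have hr : 0 < fl.sqrt w := by rw [hsqrt]; exact mul_pos (Real.sqrt_pos.2 hw) hp
  have hne : ∀ i j, i ≠ k → R' i j = R i j := fun i j hi => by simp [hR', hi]
  have hlt : ∀ j, j < k → R' k j = 0 := fun j hj => by simp [hR', hj]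
  have hkk : R' k k = fl.sqrt w := by simp [hR']
  have hgt : ∀ j, k < j → R' k j =
      fl.div (flSubDot fl (A k j) (fun i => R i k) (fun i => R i j) k) (fl.sqrt w) :=
    fun j hj => by simp [hR', hj.not_gt, hj.ne']
  have hup : ∀ i j : Fin n, j < i → R' i j = 0 := fun i j hij => by
    rcases eq_or_ne i k with rfl | hi
    · exact hlt j hij
    · rw [hne i j hi, h.upper i j hij]
  refine ⟨R', hstep, ⟨fun i j hi => ?_, hup, fun i hi => ?_, fun i j hi hij => ?_⟩⟩
  · rw [hne i j (by rintro rfl; omega), h.row_eq_zero i j (by omega)]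
  · rcases lt_or_eq_of_le (Nat.lt_succ_iff.1 hi) with hik | hik
    · rw [hne i i (by rintro rfl; omega)]
      exact h.diag_pos i hik
    · obtain rfl : i = k := Fin.ext hik
      rwa [hkk]
  · rcases lt_or_eq_of_le (Nat.lt_succ_iff.1 hi) with hik | hik
    · have e : ∀ l, R' l i * R' l j = R l i * R l j := fun l => by
        rcases eq_or_ne l k with rfl | hl
        · rw [hlt i hik, h.upper l i hik, zero_mul, zero_mul]
        · rw [hne l i hl, hne l j hl]
      simp only [← abs_mul, e]
      simpa only [← abs_mul] using h.err i j hik hij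
    · obtain rfl : i = k := Fin.ext hik
      have e : ∀ l ∈ Finset.Iio i, ∀ j, R' l j = R l j := fun l hl j =>
        hne l j (Finset.mem_Iio.1 hl).ne
      have e1 : ∑ l ∈ Finset.Iio i, R' l i * R' l j = ∑ l ∈ Finset.Iio i, R l i * R l j :=
        Finset.sum_congr rfl fun l hl => by rw [e l hl, e l hl]
      have e2 : ∑ l ∈ Finset.Iio i, |R' l i| * |R' l j| = ∑ l ∈ Finset.Iio i, |R l i| * |R l j| :=
        Finset.sum_congr rfl fun l hl => by rw [e l hl, e l hl]
      rw [sum_eq_sum_Iio_add _ i fun l hl => by rw [hup l i hl, zero_mul],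
        sum_eq_sum_Iio_add _ i fun l hl => by rw [hup l i hl, abs_zero, zero_mul],
        e1, e2, ← abs_mul]
      have hT : 0 ≤ ∑ l ∈ Finset.Iio i, |R l i| * |R l j| :=
        Finset.sum_nonneg fun _ _ => mul_nonneg (abs_nonneg _) (abs_nonneg _)
      have hm : roundErr u i ≤ roundErr u (n + 1) := roundErr_mono h0 h1 (by omega)
      rcases eq_or_lt_of_le hij with rfl | hij
      · obtain ⟨c, hc, hc1, hb⟩ := flSubDot_err fl h0 h1 (A i i) (fun l => R l i)
          (fun l => R l i) i
        obtain ⟨hc', hc1'⟩ := roundErr_div_step h0 h1 hc hc1 hδ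
        obtain ⟨-, hc2⟩ := roundErr_div_step h0 h1 hc' hc1' hδ
        have hwc : w * c = R' i i * R' i i * (c / (1 + δ) / (1 + δ)) := by
          rw [hkk, hsqrt]
          have := Real.mul_self_sqrt hw.le
          field_simp
          rw [sq, this]
        rw [← hwdef, hwc] at hb
        exact abs_sub_le_of_coeff (hc2.trans (roundErr_mono h0 h1 (by omega)))
          (hb.trans (mul_le_mul_of_nonneg_right hm hT))
      · obtain ⟨c, hc, hc1, hb⟩ := flSubDot_err fl h0 h1 (A i j) (fun l => R l i)
          (fun l => R l j) i
        obtain ⟨η, hη, hdiv⟩ := exists_rel_err h0 (fl.div_err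
          (flSubDot fl (A i j) (fun l => R l i) (fun l => R l j) i) _ hr.ne')
        rw [← hgt j hij] at hdiv
        obtain ⟨-, hc1'⟩ := roundErr_div_step h0 h1 hc hc1 hη
        have hp' : 1 + η ≠ 0 := by have := abs_le.1 hη; linarith
        have hwc : flSubDot fl (A i j) (fun l => R l i) (fun l => R l j) i * c =
            R' i i * R' i j * (c / (1 + η)) := by
          rw [hkk, hdiv]
          field_simp
        rw [hwc] at hb
        exact abs_sub_le_of_coeff (hc1'.trans (roundErr_mono h0 h1 (by omega)))
          (hb.trans (mul_le_mul_of_nonneg_right hm hT))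

theorem dotProduct_mulVec_eq_sum (E : Matrix (Fin n) (Fin n) ℝ) (y : Fin n → ℝ) :
    y ⬝ᵥ (E *ᵥ y) = ∑ i, ∑ j, y i * y j * E i j := by
  simp only [dotProduct, mulVec, Finset.mul_sum]
  exact Finset.sum_congr rfl fun i _ => Finset.sum_congr rfl fun j _ => by ring

theorem exists_mulVec_eq_col {R : Matrix (Fin n) (Fin n) ℝ} {k : Fin n}
    (hz : ∀ i j, k ≤ i → R i j = 0) (hu : ∀ i j, j < i → R i j = 0)
    (hd : ∀ i, i < k → R i i ≠ 0) :
    ∃ z : Fin n → ℝ, (∀ i, k ≤ i → z i = 0) ∧ ∀ i, (R *ᵥ z) i = R i k := by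
  set P : Matrix (Fin n) (Fin n) ℝ := fun i j =>
    if k ≤ i then (1 : Matrix (Fin n) (Fin n) ℝ) i j else R i j with hP
  have hPu : P.BlockTriangular id := fun i j hij => by
    have hij : j < i := hij
    simp only [hP]
    split_ifs
    · exact Matrix.one_apply_ne hij.ne'
    · exact hu i j hij
  have hdet : IsUnit P.det := by
    rw [Matrix.det_of_isUpperTriangular hPu, isUnit_iff_ne_zero, Finset.prod_ne_zero_iff]
    intro i _
    simp only [hP]
    split_ifs with h
    · simp
    · exact hd i (not_le.1 h)
  have hPz : P *ᵥ (P⁻¹ *ᵥ fun i => R i k) = fun i => R i k := by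
    rw [Matrix.mulVec_mulVec, Matrix.mul_nonsing_inv _ hdet, Matrix.one_mulVec]
  set z := P⁻¹ *ᵥ fun i => R i k
  refine ⟨z, fun i hi => ?_, fun i => ?_⟩
  · have := congrFun hPz i
    simp only [mulVec, dotProduct, hP, if_pos hi, Matrix.one_apply] at this
    simpa [hz i k hi] using this
  · by_cases hi : k ≤ i
    · simp [mulVec, dotProduct, hz i _ hi]
    · have := congrFun hPz i
      simpa only [mulVec, dotProduct, hP, if_neg hi] using this

theorem CholeskyRows.pivot_pos (h0 : 0 ≤ u) (h1 : u < 1) {A R : Matrix (Fin n) (Fin n) ℝ}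
    {k : Fin n} {lam : ℝ} (h : CholeskyRows (roundErr u (n + 1)) A k R) (hlam : 0 < lam)
    (hA : ∀ z, lam * (z ⬝ᵥ z) ≤ z ⬝ᵥ (symUpper A *ᵥ z)) (hφ : roundErr u (n + 1) < 1)
    (htr : 4 * roundErr u (n + 1) * ∑ i, A i i ≤ lam * (1 - roundErr u (n + 1))) :
    0 < flSubDot fl (A k k) (fun i => R i k) (fun i => R i k) k := by
  by_contra! hw
  set φ := roundErr u (n + 1)
  have hφ0 : 0 ≤ φ := roundErr_nonneg h0 h1 _
  obtain ⟨z, hz0, hRz⟩ := exists_mulVec_eq_col (k := k) h.row_eq_zero h.upper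
    fun i hi => (h.diag_pos i hi).ne'
  -- the test vector, annihilated by the rows computed so far
  set y : Fin n → ℝ := z - Pi.single k 1 with hy
  have hRy : R *ᵥ y = 0 := by
    rw [hy, Matrix.mulVec_sub]
    ext i
    simp [hRz, Matrix.col_apply]
  have hyk : y k = -1 := by simp [hy, hz0]
  have hyz : ∀ i, i ≠ k → y i = z i := fun i hi => by simp [hy, hi]
  have hygt : ∀ i, k < i → y i = 0 := fun i hi => by rw [hyz i hi.ne', hz0 i hi.le]
  have hyy : y ⬝ᵥ y = z ⬝ᵥ z + 1 := by
    simp [hy, dotProduct_sub, sub_dotProduct, hz0]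
  -- the defect at the pivot
  have hpiv : A k k - ∑ l, R l k * R l k ≤ φ * ∑ l, |R l k| * |R l k| := by
    obtain ⟨c, hc, -, hb⟩ := flSubDot_err fl h0 h1 (A k k) (fun l => R l k) (fun l => R l k) k
    have hkz : R k k = 0 := h.row_eq_zero k k le_rfl
    rw [sum_eq_sum_Iio_add (fun l => R l k * R l k) k fun l hl => by rw [h.upper l k hl, zero_mul],
      sum_eq_sum_Iio_add (fun l => |R l k| * |R l k|) k
        fun l hl => by rw [h.upper l k hl, abs_zero, zero_mul], hkz]
    have hT : 0 ≤ ∑ l ∈ Finset.Iio k, |R l k| * |R l k| :=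
      Finset.sum_nonneg fun _ _ => mul_nonneg (abs_nonneg _) (abs_nonneg _)
    have hm : roundErr u k ≤ φ := roundErr_mono h0 h1 (by omega)
    have := (abs_le.1 hb).2
    have := mul_nonpos_of_nonpos_of_nonneg hw hc.le
    have := mul_le_mul_of_nonneg_right hm hT
    simp only [abs_zero, mul_zero, add_zero]
    linarith
  have hterm : ∀ i j, y i * y j * (symUpper A - Rᵀ * R) i j ≤
      φ * ∑ l, (|y i| * |R l i|) * (|y j| * |R l j|) := by
    intro i j
    have hrhs : φ * ∑ l, (|y i| * |R l i|) * (|y j| * |R l j|) =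
        |y i * y j| * (φ * ∑ l, |R l i| * |R l j|) := by
      rw [Finset.mul_sum, Finset.mul_sum, Finset.mul_sum, abs_mul]
      exact Finset.sum_congr rfl fun l _ => by ring
    rw [hrhs]
    have key : ∀ i j : Fin n, i < k → i ≤ j →
        |A i j - (Rᵀ * R) i j| ≤ φ * ∑ l, |R l i| * |R l j| := fun i j hi hij => by
      rw [abs_sub_comm, Matrix.mul_apply]
      exact h.err i j hi hij
    have fin : |(symUpper A - Rᵀ * R) i j| ≤ φ * ∑ l, |R l i| * |R l j| →
        y i * y j * (symUpper A - Rᵀ * R) i j ≤ |y i * y j| * (φ * ∑ l, |R l i| * |R l j|) :=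
      fun hle => (le_abs_self _).trans (by
        rw [abs_mul]; exact mul_le_mul_of_nonneg_left hle (abs_nonneg _))
    rcases lt_or_ge k i with hi | hi
    · simp [hygt i hi]
    rcases lt_or_ge k j with hj | hj
    · simp [hygt j hj]
    rcases le_total i j with hij | hij
    · rcases lt_or_eq_of_le hi with hik | rfl
      · refine fin ?_
        rw [Matrix.sub_apply, symUpper, if_pos hij]
        exact key i j hik hij
      · obtain rfl : j = i := le_antisymm hj hij
        rw [hyk, Matrix.sub_apply, symUpper, if_pos le_rfl, Matrix.mul_apply]
        simpa using hpiv
    · rcases lt_or_eq_of_le hj with hjk | rfl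
      · refine fin ?_
        have hs : (Rᵀ * R) i j = (Rᵀ * R) j i := by
          simp only [Matrix.mul_apply, Matrix.transpose_apply, mul_comm]
        have hsA : symUpper A i j = A j i := by
          rcases eq_or_lt_of_le hij with rfl | hlt
          · simp [symUpper]
          · simp [symUpper, hlt.not_ge]
        rw [Matrix.sub_apply, hsA, hs]
        simpa only [mul_comm] using key j i hjk hij
      · obtain rfl : i = j := le_antisymm hi hij
        rw [hyk, Matrix.sub_apply, symUpper, if_pos le_rfl, Matrix.mul_apply]
        simpa using hpiv
  have hquad : y ⬝ᵥ (symUpper A *ᵥ y) ≤ φ * ∑ l, (∑ i, |y i| * |R l i|) ^ 2 := by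
    have e1 : y ⬝ᵥ (symUpper A *ᵥ y) = y ⬝ᵥ ((symUpper A - Rᵀ * R) *ᵥ y) := by
      rw [Matrix.sub_mulVec, dotProduct_sub, ← mulVec_dotProduct_mulVec, hRy]
      simp
    rw [e1, dotProduct_mulVec_eq_sum]
    refine (Finset.sum_le_sum fun i _ => Finset.sum_le_sum fun j _ => hterm i j).trans_eq ?_
    simp only [← Finset.mul_sum]
    congr 1
    simp only [sq, Finset.sum_mul_sum]
    exact (Finset.sum_congr rfl fun i _ => Finset.sum_comm).trans Finset.sum_comm
  -- column `k` of the computed rows is controlled by the earlier columns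
  have hcol : ∀ l, ∑ i, |y i| * |R l i| ≤ 2 * ∑ i ∈ Finset.Iio k, |z i| * |R l i| := by
    intro l
    have e1 : ∑ i ∈ Finset.Iio k, |y i| * |R l i| = ∑ i ∈ Finset.Iio k, |z i| * |R l i| :=
      Finset.sum_congr rfl fun i hi => by rw [hyz i (Finset.mem_Iio.1 hi).ne]
    have e2 : |R l k| ≤ ∑ i ∈ Finset.Iio k, |z i| * |R l i| := by
      rw [← hRz l, mulVec, dotProduct,
        sum_eq_sum_Iio_add _ k fun i hi => by rw [hz0 i hi.le, mul_zero], hz0 k le_rfl, mul_zero,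
        add_zero]
      refine (Finset.abs_sum_le_sum_abs _ _).trans_eq ?_
      exact Finset.sum_congr rfl fun i _ => by rw [abs_mul, mul_comm]
    rw [sum_eq_sum_Iio_add _ k fun i hi => by rw [hygt i hi, abs_zero, zero_mul], e1, hyk]
    simp only [abs_neg, abs_one, one_mul]
    linarith
  have hzz : ∑ i ∈ Finset.Iio k, |z i| ^ 2 ≤ z ⬝ᵥ z := by
    simp only [sq_abs, dotProduct, ← sq]
    exact Finset.sum_le_sum_of_subset_of_nonneg (Finset.subset_univ _) fun _ _ _ => sq_nonneg _
  set T := ∑ i ∈ Finset.Iio k, ∑ l, |R l i| ^ 2 with hTdef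
  have hT0 : 0 ≤ T := Finset.sum_nonneg fun _ _ => Finset.sum_nonneg fun _ _ => sq_nonneg _
  have hsum : ∑ l, (∑ i, |y i| * |R l i|) ^ 2 ≤ 4 * (z ⬝ᵥ z) * T := by
    rw [hTdef, Finset.sum_comm, Finset.mul_sum]
    refine Finset.sum_le_sum fun l _ => ?_
    have hnn : 0 ≤ ∑ i, |y i| * |R l i| :=
      Finset.sum_nonneg fun _ _ => mul_nonneg (abs_nonneg _) (abs_nonneg _)
    have h1 := pow_le_pow_left₀ hnn (hcol l) 2
    have h2 := Finset.sum_mul_sq_le_sq_mul_sq (Finset.Iio k) (fun i => |z i|) (fun i => |R l i|)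
    have h3 : 0 ≤ ∑ i ∈ Finset.Iio k, |R l i| ^ 2 := Finset.sum_nonneg fun _ _ => sq_nonneg _
    have h4 := mul_le_mul_of_nonneg_right hzz h3
    rw [mul_pow] at h1
    linarith
  have hdiag : ∀ i, 0 ≤ A i i := fun i => by
    have := hA (Pi.single i 1)
    simp [symUpper, Matrix.col_apply] at this
    linarith
  have hTtr : (1 - φ) * T ≤ ∑ i, A i i := by
    calc (1 - φ) * T = ∑ i ∈ Finset.Iio k, (1 - φ) * ∑ l, |R l i| ^ 2 := Finset.mul_sum _ _ _
      _ ≤ ∑ i ∈ Finset.Iio k, A i i := Finset.sum_le_sum fun i hi => by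
        have := (abs_le.1 (h.err i i (Fin.lt_def.1 (Finset.mem_Iio.1 hi)) le_rfl)).2
        simp only [← sq, sq_abs] at this ⊢
        linarith
      _ ≤ _ := Finset.sum_le_sum_of_subset_of_nonneg (Finset.subset_univ _) fun i _ _ => hdiag i
  have hz2 : 0 ≤ z ⬝ᵥ z := dotProduct_self_nonneg z
  have hlamT : 4 * φ * T ≤ lam := by
    have h3 : (4 * φ * T) * (1 - φ) ≤ lam * (1 - φ) := by
      refine le_trans ?_ htr
      nlinarith [mul_le_mul_of_nonneg_left hTtr hφ0]
    exact le_of_mul_le_mul_right h3 (by linarith)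
  have hfin := (hA y).trans (hquad.trans (mul_le_mul_of_nonneg_left hsum hφ0))
  rw [hyy] at hfin
  nlinarith [mul_le_mul_of_nonneg_right hlamT hz2]

/-- Floating-point Cholesky factorization runs to completion for sufficiently positive definite
matrices, with a small backward error. -/
theorem flCholesky_spec (h0 : 0 ≤ u) (h1 : u < 1) {A : Matrix (Fin n) (Fin n) ℝ} {lam : ℝ}
    (hlam : 0 < lam) (hA : ∀ z, lam * (z ⬝ᵥ z) ≤ z ⬝ᵥ (symUpper A *ᵥ z))
    (hφ : roundErr u (n + 1) < 1)
    (htr : 4 * roundErr u (n + 1) * ∑ i, A i i ≤ lam * (1 - roundErr u (n + 1))) :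
    ∃ R, flCholesky fl A = some R ∧ (∀ i j, j < i → R i j = 0) ∧ (∀ i, 0 < R i i) ∧
      ∀ i j, |(Rᵀ * R - symUpper A) i j| ≤ roundErr u (n + 1) * ∑ l, |R l i| * |R l j| := by
  obtain ⟨R, hR, h⟩ := foldlM_finRange_induction
    (CholeskyRows (roundErr u (n + 1)) A) (fun R k => flCholeskyStep fl A R k) 0
    ⟨fun _ _ _ => rfl, fun _ _ _ => rfl, fun _ hi => absurd hi (by omega),
      fun _ _ hi => absurd hi (by omega)⟩
    fun k R h => h.step fl h0 h1 (h.pivot_pos fl h0 h1 hlam hA hφ htr)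
  refine ⟨R, hR, h.upper, fun i => h.diag_pos i i.2, fun i j => ?_⟩
  rw [Matrix.sub_apply, Matrix.mul_apply, symUpper]
  split_ifs with hij
  · exact h.err i j i.2 hij
  · have := h.err j i j.2 (not_le.1 hij).le
    simpa only [Matrix.transpose_apply, mul_comm] using this

end Cholesky


section Stages

variable {u : ℝ} {m n : ℕ}

theorem roundErr_bounds (h0 : 0 ≤ u) (h1 : u < 1) (hn : 0 < n) {k : ℕ}
    (h : n * k * u ≤ 1 / 64) :
    roundErr u k ≤ 1 / 63 ∧ n * roundErr u k ≤ 64 / 63 * (n * k * u) := by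
  have hn1 : (1 : ℝ) ≤ n := by exact_mod_cast hn
  have hku : 0 ≤ k * u := by positivity
  have hk : k * u ≤ 1 / 64 := by nlinarith
  have hb : roundErr u k ≤ 64 / 63 * (k * u) := by
    refine (roundErr_le h1 (by linarith)).trans ?_
    rw [div_le_iff₀ (by linarith)]
    nlinarith
  refine ⟨by linarith, ?_⟩
  nlinarith [mul_le_mul_of_nonneg_left hb (by linarith : (0 : ℝ) ≤ n)]

theorem abs_symUpper_sub_le {M S B : Matrix (Fin n) (Fin n) ℝ} (hS : Sᵀ = S) (hB : Bᵀ = B)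
    (h : ∀ i j, |(M - S) i j| ≤ B i j) (i j : Fin n) : |(symUpper M - S) i j| ≤ B i j := by
  rw [Matrix.sub_apply, symUpper]
  split_ifs
  · exact h i j
  · rw [← hS, ← hB]
    exact h j i

/-- Perturbation of the quadratic form of a shifted Gram matrix. -/
theorem mulVec_sq_of_gram_eq {A : Matrix (Fin m) (Fin n) ℝ} {R E : Matrix (Fin n) (Fin n) ℝ}
    {s η : ℝ} (h : Rᵀ * R = Aᵀ * A + s • (1 : Matrix (Fin n) (Fin n) ℝ) + E) (hE : norm2 E ≤ η)
    (z : Fin n → ℝ) :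
    |(R *ᵥ z) ⬝ᵥ (R *ᵥ z) - ((A *ᵥ z) ⬝ᵥ (A *ᵥ z) + s * (z ⬝ᵥ z))| ≤ η * (z ⬝ᵥ z) := by
  have e : (R *ᵥ z) ⬝ᵥ (R *ᵥ z) - ((A *ᵥ z) ⬝ᵥ (A *ᵥ z) + s * (z ⬝ᵥ z)) = z ⬝ᵥ (E *ᵥ z) := by
    rw [mulVec_dotProduct_mulVec, mulVec_dotProduct_mulVec, h]
    simp only [Matrix.add_mulVec, Matrix.smul_mulVec, Matrix.one_mulVec, dotProduct_add,
      dotProduct_smul, smul_eq_mul]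
    ring
  rw [e]
  exact (abs_dotProduct_mulVec_le E z).trans
    (mul_le_mul_of_nonneg_right hE (dotProduct_self_nonneg z))

theorem isUnit_det_of_upper {R : Matrix (Fin n) (Fin n) ℝ} (hR : ∀ i j, j < i → R i j = 0)
    (hd : ∀ i, 0 < R i i) : IsUnit R.det := by
  have hu : R.BlockTriangular id := fun i j hij => hR i j hij
  rw [Matrix.det_of_isUpperTriangular hu, isUnit_iff_ne_zero, Finset.prod_ne_zero_iff]
  exact fun i _ => (hd i).ne'

/-- Cholesky factorization of a perturbed, shifted Gram matrix. -/
theorem flCholesky_gram (fl : FlArith u) (h0 : 0 ≤ u) (h1 : u < 1)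
    {A : Matrix (Fin m) (Fin n) ℝ} {M : Matrix (Fin n) (Fin n) ℝ} {s η α τ : ℝ}
    (hφ : roundErr u (n + 1) < 1)
    (hM : norm2 (symUpper M - (Aᵀ * A + s • (1 : Matrix (Fin n) (Fin n) ℝ))) ≤ η)
    (hA : ∀ z, α ^ 2 * (z ⬝ᵥ z) ≤ (A *ᵥ z) ⬝ᵥ (A *ᵥ z)) (hpos : 0 < α ^ 2 + s - η)
    (hτ : ∑ i, M i i ≤ τ)
    (hlam : 4 * roundErr u (n + 1) * τ ≤ (α ^ 2 + s - η) * (1 - roundErr u (n + 1))) :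
    ∃ R, flCholesky fl M = some R ∧ (∀ i j, j < i → R i j = 0) ∧ (∀ i, 0 < R i i) ∧
      normF R ^ 2 * (1 - roundErr u (n + 1)) ≤ τ ∧
      normF (Rᵀ * R - symUpper M) ≤ roundErr u (n + 1) * normF R ^ 2 := by
  have hr := roundErr_nonneg h0 h1 (n + 1)
  have hquad : ∀ z, (α ^ 2 + s - η) * (z ⬝ᵥ z) ≤ z ⬝ᵥ (symUpper M *ᵥ z) := fun z => by
    have e : z ⬝ᵥ (symUpper M *ᵥ z) = (A *ᵥ z) ⬝ᵥ (A *ᵥ z) + s * (z ⬝ᵥ z) +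
        z ⬝ᵥ ((symUpper M - (Aᵀ * A + s • (1 : Matrix (Fin n) (Fin n) ℝ))) *ᵥ z) := by
      rw [mulVec_dotProduct_mulVec]
      simp only [Matrix.sub_mulVec, Matrix.add_mulVec, Matrix.smul_mulVec, Matrix.one_mulVec,
        dotProduct_add, dotProduct_sub, dotProduct_smul, smul_eq_mul]
      ring
    have h2 := (abs_le.1 ((abs_dotProduct_mulVec_le _ z).trans
      (mul_le_mul_of_nonneg_right hM (dotProduct_self_nonneg z)))).1
    have := hA z
    rw [e]
    linarith
  obtain ⟨R, hR, hup, hd, herr⟩ := flCholesky_spec fl h0 h1 hpos hquad hφ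
    ((mul_le_mul_of_nonneg_left hτ (by positivity)).trans hlam)
  refine ⟨R, hR, hup, hd, ?_, ?_⟩
  · refine le_trans ?_ hτ
    rw [normF_sq, Finset.sum_comm, Finset.sum_mul]
    refine Finset.sum_le_sum fun i _ => ?_
    have := (abs_le.1 (herr i i)).2
    simp only [Matrix.sub_apply, Matrix.mul_apply, Matrix.transpose_apply, symUpper, le_refl,
      if_true, ← sq, sq_abs] at this
    linarith
  · have := normF_le_of_abs_le_mul (A := Rᵀ) (B := R) hr herr
    rwa [normF_transpose, ← sq] at this

/-- Orthogonality of `Q` when `Q R ≈ A` and `Rᵀ R ≈ Aᵀ A`. -/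
theorem orthogonality_of_perturbed {A Q : Matrix (Fin m) (Fin n) ℝ}
    {R : Matrix (Fin n) (Fin n) ℝ} {r e₀ h₀ e h : ℝ} (hR : IsUnit R.det) (hr : norm2 R⁻¹ ≤ r)
    (hE : normF (Rᵀ * R - Aᵀ * A) ≤ e₀) (hQ : normF (Q * R - A) ≤ h₀ * norm2 Q)
    (he : r ^ 2 * e₀ ≤ e) (he' : e ≤ 3 / 25) (hh : h₀ * r ≤ h) (hh0 : 0 ≤ h) (hh' : h ≤ 1 / 32) :
    norm2 Q ≤ 11 / 10 ∧ normF (Qᵀ * Q - 1) ≤ e + 12 / 5 * h := by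
  set B := A * R⁻¹ with hB
  set C := (Q * R - A) * R⁻¹ with hC
  have hr0 : 0 ≤ r := (norm2_nonneg _).trans hr
  have hsum : Q = B + C := by
    rw [hB, hC, ← Matrix.add_mul, add_sub_cancel, Matrix.mul_assoc, Matrix.mul_nonsing_inv _ hR,
      Matrix.mul_one]
  have hBB : Bᵀ * B - 1 = -((R⁻¹)ᵀ * (Rᵀ * R - Aᵀ * A) * R⁻¹) := by
    have e1 : (R⁻¹)ᵀ * (Rᵀ * R) * R⁻¹ = 1 := by
      rw [← Matrix.mul_assoc, ← Matrix.transpose_mul, Matrix.mul_nonsing_inv _ hR,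
        Matrix.transpose_one, Matrix.one_mul, Matrix.mul_nonsing_inv _ hR]
    rw [Matrix.mul_sub, Matrix.sub_mul, e1, hB, Matrix.transpose_mul]
    simp only [Matrix.mul_assoc, neg_sub]
  have hBBn : normF (Bᵀ * B - 1) ≤ e := by
    rw [hBB, normF_neg]
    calc _ ≤ normF ((R⁻¹)ᵀ * (Rᵀ * R - Aᵀ * A)) * norm2 R⁻¹ := normF_mul_le_mul_norm2 _ _
      _ ≤ norm2 (R⁻¹)ᵀ * normF (Rᵀ * R - Aᵀ * A) * norm2 R⁻¹ :=
        mul_le_mul_of_nonneg_right (normF_mul_le_norm2_mul _ _) (norm2_nonneg _)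
      _ ≤ r * e₀ * r := by
        rw [norm2_transpose]
        have := (normF_nonneg _).trans hE
        exact mul_le_mul (mul_le_mul hr hE (normF_nonneg _) hr0) hr (norm2_nonneg _)
          (mul_nonneg hr0 this)
      _ ≤ e := by linarith
  have hB2 : norm2 B ≤ 53 / 50 := by
    refine norm2_le_of_sq_le (by norm_num) fun z => ?_
    have e1 : (B *ᵥ z) ⬝ᵥ (B *ᵥ z) = z ⬝ᵥ z + z ⬝ᵥ ((Bᵀ * B - 1) *ᵥ z) := by
      rw [mulVec_dotProduct_mulVec, Matrix.sub_mulVec, Matrix.one_mulVec, dotProduct_sub]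
      ring
    have e2 := (abs_le.1 (abs_dotProduct_mulVec_le (Bᵀ * B - 1) z)).2
    have e3 := norm2_le_normF (Bᵀ * B - 1)
    have e4 := dotProduct_self_nonneg z
    rw [e1]
    nlinarith
  have hQ0 := norm2_nonneg Q
  have hCn : normF C ≤ h * norm2 Q := by
    calc normF C ≤ normF (Q * R - A) * norm2 R⁻¹ := normF_mul_le_mul_norm2 _ _
      _ ≤ (h₀ * norm2 Q) * r := mul_le_mul hQ hr (norm2_nonneg _) ((normF_nonneg _).trans hQ)
      _ = (h₀ * r) * norm2 Q := by ring
      _ ≤ _ := mul_le_mul_of_nonneg_right hh hQ0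
  have hQ2 : norm2 Q ≤ 11 / 10 := by
    have e1 : norm2 Q ≤ norm2 B + norm2 C := by
      conv_lhs => rw [hsum]
      exact norm2_add_le _ _
    have e2 := norm2_le_normF C
    nlinarith
  refine ⟨hQ2, ?_⟩
  have hC' : normF C ≤ 11 / 10 * h := by nlinarith
  have hBC : normF (Bᵀ * C) ≤ 53 / 50 * (11 / 10 * h) :=
    (normF_mul_le_norm2_mul _ _).trans (by
      rw [norm2_transpose]
      exact mul_le_mul hB2 hC' (normF_nonneg _) (by norm_num))
  have hCC : normF (Cᵀ * C) ≤ (11 / 10 * h) * (11 / 10 * h) :=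
    (normF_mul_le _ _).trans (by
      rw [normF_transpose]
      exact mul_le_mul hC' hC' (normF_nonneg _) (by positivity))
  have e1 : Qᵀ * Q - 1 = (Bᵀ * B - 1) + (Bᵀ * C + (Bᵀ * C)ᵀ) + Cᵀ * C := by
    rw [hsum, Matrix.transpose_mul Bᵀ C, Matrix.transpose_transpose, Matrix.transpose_add,
      Matrix.add_mul, Matrix.mul_add, Matrix.mul_add]
    abel
  rw [e1]
  have e2 := normF_add_le ((Bᵀ * B - 1) + (Bᵀ * C + (Bᵀ * C)ᵀ)) (Cᵀ * C)
  have e3 := normF_add_le (Bᵀ * B - 1) (Bᵀ * C + (Bᵀ * C)ᵀ)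
  have e4 := normF_add_le (Bᵀ * C) (Bᵀ * C)ᵀ
  rw [normF_transpose] at e4
  nlinarith

theorem flGram_diag_err (fl : FlArith u) (h0 : 0 ≤ u) (h1 : u < 1) (A : Matrix (Fin m) (Fin n) ℝ)
    (i : Fin n) : |flMatMul fl Aᵀ A i i - ∑ t, A t i ^ 2| ≤ roundErr u m * ∑ t, A t i ^ 2 := by
  have := flMatMul_err fl h0 h1 Aᵀ A i i
  simpa only [Matrix.sub_apply, Matrix.mul_apply, Matrix.transpose_apply, ← sq, sq_abs] using this

theorem normF_symUpper_flGram_sub_le (fl : FlArith u) (h0 : 0 ≤ u) (h1 : u < 1)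
    (A : Matrix (Fin m) (Fin n) ℝ) :
    normF (symUpper (flMatMul fl Aᵀ A) - Aᵀ * A) ≤ roundErr u m * normF A ^ 2 := by
  have := normF_le_of_abs_le_mul (A := Aᵀ) (B := A) (roundErr_nonneg h0 h1 m)
    (abs_symUpper_sub_le (M := flMatMul fl Aᵀ A) (S := Aᵀ * A)
      (B := fun i j => roundErr u m * ∑ t, |Aᵀ i t| * |A t j|)
      (by rw [Matrix.transpose_mul, Matrix.transpose_transpose])
      (by
        ext i j
        change roundErr u m * ∑ t, |A t j| * |A t i| = roundErr u m * ∑ t, |A t i| * |A t j|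
        simp only [mul_comm]) (flMatMul_err fl h0 h1 Aᵀ A))
  rwa [normF_transpose, ← sq] at this

set_option maxHeartbeats 400000 in
/-- One step of CholeskyQR for a well-conditioned matrix. -/
theorem flCholeskyQR_spec (fl : FlArith u) (h0 : 0 ≤ u) (h1 : u < 1) (hn : 0 < n) (hnm : n ≤ m)
    (hm : m * n * u ≤ 1 / 64) (hnn : n * (n + 1) * u ≤ 1 / 64) {ε : ℝ}
    (hε : ε = m * n * u + n * (n + 1) * u) {A : Matrix (Fin m) (Fin n) ℝ} {α β : ℝ} (hα : 0 < α)
    (hβ : 0 < β) (hA : ∀ z, α ^ 2 * (z ⬝ᵥ z) ≤ (A *ᵥ z) ⬝ᵥ (A *ᵥ z)) (hA2 : norm2 A ≤ β)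
    (hαβ : 10 * ε * β ^ 2 ≤ α ^ 2) :
    ∃ Q R, flCholeskyQR fl A = some (Q, R) ∧ norm2 Q ≤ 11 / 10 ∧
      normF (Qᵀ * Q - 1) ≤ 59 / 50 * (ε * β ^ 2 / α ^ 2) + 66 / 25 * (n ^ 2 * u * β / α) ∧
      normF (Q * R - A) ≤ 26 / 25 * (n ^ 2 * u) * β * norm2 Q ∧
      normF R ≤ 51 / 50 * (Real.sqrt n * β) ∧ norm2 R ≤ 51 / 50 * β := by
  have hn1 : (1 : ℝ) ≤ n := by exact_mod_cast hn
  have hmn : (n : ℝ) ≤ m := by exact_mod_cast hnm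
  have hν0 : 0 ≤ n ^ 2 * u := by positivity
  have hν1 : n ^ 2 * u ≤ n * (n + 1) * u := by nlinarith [mul_nonneg (by linarith : (0:ℝ) ≤ n) h0]
  have hν2 : n ^ 2 * u ≤ m * n * u := by
    have : (n : ℝ) ^ 2 ≤ m * n := by nlinarith
    exact mul_le_mul_of_nonneg_right this h0
  obtain ⟨hm1, hm2⟩ := roundErr_bounds (k := m) h0 h1 hn (by linarith)
  obtain ⟨hc1, hc2⟩ := roundErr_bounds (k := n + 1) h0 h1 hn (by push_cast; linarith)
  obtain ⟨hd1, hd2⟩ := roundErr_bounds (k := n) h0 h1 hn (by nlinarith)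
  have hm0 := roundErr_nonneg h0 h1 m
  have hc0 := roundErr_nonneg h0 h1 (n + 1)
  have hd0 := roundErr_nonneg h0 h1 n
  push_cast at hc2
  have hβ2 : 0 < β ^ 2 := by positivity
  have hAF : normF A ^ 2 ≤ n * β ^ 2 := (normF_sq_le_card_mul_norm2_sq A).trans
    (mul_le_mul_of_nonneg_left (pow_le_pow_left₀ (norm2_nonneg A) hA2 2) (by linarith))
  set a := m * n * u with ha
  set c := n * (n + 1) * u with hc
  set ν := n ^ 2 * u with hν
  have ha0 : 0 ≤ a := hν0.trans hν2
  have hc0' : 0 ≤ c := hν0.trans hν1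
  have hε0 : 0 ≤ ε := by rw [hε]; linarith
  have hG : normF (symUpper (flMatMul fl Aᵀ A) - Aᵀ * A) ≤ 64 / 63 * a * β ^ 2 := by
    refine (normF_symUpper_flGram_sub_le fl h0 h1 A).trans ?_
    calc _ ≤ roundErr u m * (n * β ^ 2) := mul_le_mul_of_nonneg_left hAF hm0
      _ = (n * roundErr u m) * β ^ 2 := by ring
      _ ≤ _ := mul_le_mul_of_nonneg_right (by linarith) hβ2.le
  have htr : ∑ i, flMatMul fl Aᵀ A i i ≤ 64 / 63 * (n * β ^ 2) := by
    have e1 : ∑ i, flMatMul fl Aᵀ A i i ≤ ∑ i, 64 / 63 * ∑ t, A t i ^ 2 :=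
      Finset.sum_le_sum fun i _ => by
        have e2 := (abs_le.1 (flGram_diag_err fl h0 h1 A i)).2
        have e3 : 0 ≤ ∑ t, A t i ^ 2 := Finset.sum_nonneg fun _ _ => sq_nonneg _
        nlinarith
    rw [← Finset.mul_sum, Finset.sum_comm, ← normF_sq] at e1
    linarith
  have hal : a * β ^ 2 ≤ ε * β ^ 2 := mul_le_mul_of_nonneg_right (by linarith) hβ2.le
  have hcl : c * β ^ 2 ≤ ε * β ^ 2 := mul_le_mul_of_nonneg_right (by linarith) hβ2.le
  have hα2 : 0 < α ^ 2 := by positivity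
  have haβ0 : 0 ≤ a * β ^ 2 := by positivity
  have hcβ0 : 0 ≤ c * β ^ 2 := by positivity
  obtain ⟨R, hR, hup, hd, hRF, hRE⟩ := flCholesky_gram fl h0 h1 (A := A)
    (M := flMatMul fl Aᵀ A) (s := 0) (η := 64 / 63 * a * β ^ 2) (α := α)
    (τ := 64 / 63 * (n * β ^ 2)) (by linarith)
    (by rw [zero_smul, add_zero]; exact (norm2_le_normF _).trans hG) hA (by linarith) htr (by
      have e1 : 4 * roundErr u (n + 1) * (64 / 63 * (n * β ^ 2)) ≤
          4 * (64 / 63) * (64 / 63) * (c * β ^ 2) := by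
        linarith [mul_le_mul_of_nonneg_right hc2 hβ2.le]
      have e2 : (α ^ 2 + 0 - 64 / 63 * a * β ^ 2) * (62 / 63) ≤
          (α ^ 2 + 0 - 64 / 63 * a * β ^ 2) * (1 - roundErr u (n + 1)) :=
        mul_le_mul_of_nonneg_left (by linarith) (by linarith)
      linarith)
  have hRF' : normF R ^ 2 ≤ 64 / 62 * (n * β ^ 2) := by
    have := mul_le_mul_of_nonneg_left hc1 (sq_nonneg (normF R))
    linarith
  have hdet := isUnit_det_of_upper hup hd
  set E := Rᵀ * R - Aᵀ * A with hEdef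
  have hE : normF E ≤ 21 / 20 * (ε * β ^ 2) := by
    have e1 : E = (Rᵀ * R - symUpper (flMatMul fl Aᵀ A)) +
        (symUpper (flMatMul fl Aᵀ A) - Aᵀ * A) := by rw [hEdef]; abel
    have e2 := normF_add_le (Rᵀ * R - symUpper (flMatMul fl Aᵀ A))
      (symUpper (flMatMul fl Aᵀ A) - Aᵀ * A)
    rw [← e1] at e2
    have e3 : roundErr u (n + 1) * normF R ^ 2 ≤ 64 / 62 * (64 / 63) * (c * β ^ 2) := by
      have := mul_le_mul_of_nonneg_left hRF' hc0
      linarith [mul_le_mul_of_nonneg_right hc2 hβ2.le]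
    have e4 : ε * β ^ 2 = a * β ^ 2 + c * β ^ 2 := by rw [hε]; ring
    linarith
  have hquad := mulVec_sq_of_gram_eq (A := A) (R := R) (E := E) (s := 0)
    (by rw [hEdef, zero_smul, add_zero]; abel) ((norm2_le_normF E).trans hE)
  have hlow : ∀ z, (473 / 500 * α) ^ 2 * (z ⬝ᵥ z) ≤ (R *ᵥ z) ⬝ᵥ (R *ᵥ z) := fun z => by
    have e1 := (abs_le.1 (hquad z)).1
    have e2 := hA z
    have e3 := dotProduct_self_nonneg z
    have e4 := mul_le_mul_of_nonneg_right hαβ e3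
    have e5 := mul_nonneg hα2.le e3
    linarith
  have hinv := norm2_inv_le (by positivity) hdet hlow
  have hQR := normF_flSolve_mul_sub_le fl h0 h1 hup (fun i => (hd i).ne') A
  set Q := flSolve fl A R with hQ
  have hrn : Real.sqrt n ^ 2 = n := Real.sq_sqrt (by linarith)
  have hr0 : 0 ≤ Real.sqrt n := Real.sqrt_nonneg _
  have hRF1 : normF R ≤ 51 / 50 * (Real.sqrt n * β) := by
    refine le_of_sq_le_sq (hRF'.trans ?_) (by positivity)
    rw [mul_pow, mul_pow, hrn]
    have : 0 ≤ n * β ^ 2 := by positivity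
    linarith
  have hres : normF (Q * R - A) ≤ 26 / 25 * ν * β * norm2 Q := by
    refine hQR.trans ?_
    have hQ0 := norm2_nonneg Q
    calc roundErr u n * (normF Q * normF R)
        ≤ roundErr u n * ((Real.sqrt n * norm2 Q) * (51 / 50 * (Real.sqrt n * β))) := by
          gcongr
          exacts [normF_nonneg _, normF_le_sqrt_mul_norm2 Q]
      _ = 51 / 50 * (Real.sqrt n ^ 2 * roundErr u n) * β * norm2 Q := by ring
      _ ≤ 26 / 25 * ν * β * norm2 Q := by
          rw [hrn]
          gcongr ?_ * _ * _
          have : n * n * u = ν := by rw [hν]; ring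
          rw [this] at hd2
          linarith
  have hR2 : norm2 R ≤ 51 / 50 * β := by
    refine norm2_le_of_sq_le (by positivity) fun z => ?_
    have e1 := (abs_le.1 (hquad z)).2
    have e2 := mulVec_sq_le_of_norm2_le hA2 z
    have e3 := mul_nonneg hβ2.le (dotProduct_self_nonneg z)
    have e4 : ε ≤ 1 / 32 := by rw [hε]; linarith
    linarith [mul_le_mul_of_nonneg_right e4 e3]
  have hνε : ν ≤ ε / 2 := by rw [hε]; linarith
  have hx : ε * β ^ 2 / α ^ 2 ≤ 1 / 10 := by
    rw [div_le_iff₀ hα2]; linarith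
  have hy : ν * β / α ≤ 2 / 71 := by
    rw [div_le_iff₀ hα]
    refine le_of_sq_le_sq ?_ (by positivity)
    have e4 : ε ≤ 1 / 32 := by rw [hε]; linarith
    have e5 : ν ^ 2 ≤ ε / 2 * (1 / 64) := by
      rw [sq]
      exact mul_le_mul hνε (hν1.trans hnn) hν0 (by linarith)
    rw [mul_pow, mul_pow]
    linarith [mul_le_mul_of_nonneg_right e5 hβ2.le]
  have hy0 : 0 ≤ ν * β / α := by positivity
  have hx0 : 0 ≤ ε * β ^ 2 / α ^ 2 := by positivity
  have horth := orthogonality_of_perturbed (Q := Q) (e := 59 / 50 * (ε * β ^ 2 / α ^ 2))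
    (h₀ := 26 / 25 * ν * β) (h := 11 / 10 * (ν * β / α)) hdet hinv hE hres (by
      have : (473 / 500 * α)⁻¹ ^ 2 * (21 / 20 * (ε * β ^ 2)) =
        (500 / 473) ^ 2 * (21 / 20) * (ε * β ^ 2 / α ^ 2) := by field_simp
      rw [this]; linarith) (by linarith) (by
      have : 26 / 25 * ν * β * (473 / 500 * α)⁻¹ = 26 / 25 * (500 / 473) * (ν * β / α) := by
        field_simp
      rw [this]; linarith) (by positivity) (by linarith)
  refine ⟨Q, R, ?_, horth.1, horth.2.trans ?_, hres, hRF1, hR2⟩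
  · simp [flCholeskyQR, hR, hQ]
  · linarith

end Stages


section Shifted

variable {u : ℝ} {m n : ℕ}

theorem norm2_diagonal_le {d : Fin n → ℝ} {c : ℝ} (hc : 0 ≤ c) (h : ∀ i, |d i| ≤ c) :
    norm2 (Matrix.diagonal d) ≤ c := by
  refine norm2_le_of_sq_le hc fun z => ?_
  simp only [dotProduct, Matrix.mulVec_diagonal, Finset.mul_sum]
  refine Finset.sum_le_sum fun i _ => ?_
  have h1 : d i ^ 2 ≤ c ^ 2 := sq_le_sq' (abs_le.1 (h i)).1 (abs_le.1 (h i)).2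
  nlinarith [mul_le_mul_of_nonneg_right h1 (mul_self_nonneg (z i))]

theorem norm2_symUpper_flShift_sub_le (fl : FlArith u) {A : Matrix (Fin m) (Fin n) ℝ}
    {G : Matrix (Fin n) (Fin n) ℝ} {s c : ℝ} (hc : 0 ≤ u * c) (h0 : 0 ≤ u)
    (hG : ∀ i, |G i i + s| ≤ c) :
    norm2 (symUpper (flShift fl G s) - (Aᵀ * A + s • (1 : Matrix (Fin n) (Fin n) ℝ))) ≤
      normF (symUpper G - Aᵀ * A) + u * c := by
  have e : symUpper (flShift fl G s) - (Aᵀ * A + s • (1 : Matrix (Fin n) (Fin n) ℝ)) =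
      (symUpper G - Aᵀ * A) + Matrix.diagonal fun i => fl.add (G i i) s - (G i i + s) := by
    ext i j
    rcases eq_or_ne i j with rfl | hij
    · simp [symUpper, flShift]
      ring
    · simp [symUpper, flShift, hij, hij.symm]
  rw [e]
  refine (norm2_add_le _ _).trans (add_le_add (norm2_le_normF _) (norm2_diagonal_le hc fun i => ?_))
  exact (fl.add_err _ _).trans (mul_le_mul_of_nonneg_left (hG i) h0)

theorem mulVec_add_sq_ge {B C : Matrix (Fin m) (Fin n) ℝ} {b c : ℝ} (hcb : c ≤ b)
    (hB : ∀ z, b ^ 2 * (z ⬝ᵥ z) ≤ (B *ᵥ z) ⬝ᵥ (B *ᵥ z)) (hC : norm2 C ≤ c) (z : Fin n → ℝ) :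
    (b - c) ^ 2 * (z ⬝ᵥ z) ≤ ((B + C) *ᵥ z) ⬝ᵥ ((B + C) *ᵥ z) := by
  have h1 := hB z
  have h2 := mulVec_sq_le_of_norm2_le hC z
  have hc : 0 ≤ c := (norm2_nonneg C).trans hC
  simp only [← norm_toLp_sq, ← mul_pow] at h1 h2 ⊢
  have h1' := le_of_sq_le_sq h1 (norm_nonneg _)
  have h2' := le_of_sq_le_sq h2 (mul_nonneg hc (norm_nonneg _))
  refine pow_le_pow_left₀ (mul_nonneg (by linarith) (norm_nonneg _)) ?_ 2
  have e : WithLp.toLp 2 (B *ᵥ z) = WithLp.toLp 2 ((B + C) *ᵥ z) - WithLp.toLp 2 (C *ᵥ z) := by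
    rw [Matrix.add_mulVec, WithLp.toLp_add, add_sub_cancel_right]
  have h3 := norm_sub_le (WithLp.toLp 2 ((B + C) *ᵥ z)) (WithLp.toLp 2 (C *ᵥ z))
  rw [← e] at h3
  linarith

/-- The conditioning of the preconditioned matrix `W ≈ X Y⁻¹`. -/
theorem shifted_preconditioner {X W : Matrix (Fin m) (Fin n) ℝ} {Y : Matrix (Fin n) (Fin n) ℝ}
    {g q ν σ : ℝ} (hg : 0 < g) (hq : 0 < q) (hq1 : q ≤ 177 / 1000) (hν : ν ≤ q ^ 2 / 2)
    (hν0 : 0 ≤ ν) (hY : IsUnit Y.det) (hσ : 86 * q ^ 2 * g ≤ σ)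
    (hX : ∀ z, σ ^ 2 * (z ⬝ᵥ z) ≤ (X *ᵥ z) ⬝ᵥ (X *ᵥ z))
    (hlow : ∀ z, 91 / 10 * (q ^ 2 * g ^ 2) * (z ⬝ᵥ z) ≤ (Y *ᵥ z) ⬝ᵥ (Y *ᵥ z))
    (hXY : ∀ z, (X *ᵥ z) ⬝ᵥ (X *ᵥ z) ≤ (Y *ᵥ z) ⬝ᵥ (Y *ᵥ z))
    (hup : ∀ z, (Y *ᵥ z) ⬝ᵥ (Y *ᵥ z) ≤
      (X *ᵥ z) ⬝ᵥ (X *ᵥ z) + 129 / 10 * (q ^ 2 * g ^ 2) * (z ⬝ᵥ z))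
    (hres : normF (W * Y - X) ≤ 121 / 100 * ν * g * norm2 W) :
    norm2 W ≤ 1037 / 1000 ∧ ∀ z, (5 * q) ^ 2 * (z ⬝ᵥ z) ≤ (W *ᵥ z) ⬝ᵥ (W *ᵥ z) := by
  set B := X * Y⁻¹ with hB
  set C := (W * Y - X) * Y⁻¹ with hC
  have hsum : W = B + C := by
    rw [hB, hC, ← Matrix.add_mul, add_sub_cancel, Matrix.mul_assoc, Matrix.mul_nonsing_inv _ hY,
      Matrix.mul_one]
  have hYz : ∀ z, Y *ᵥ (Y⁻¹ *ᵥ z) = z := fun z => by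
    rw [Matrix.mulVec_mulVec, Matrix.mul_nonsing_inv _ hY, Matrix.one_mulVec]
  have hBz : ∀ z, B *ᵥ z = X *ᵥ (Y⁻¹ *ᵥ z) := fun z => by rw [hB, Matrix.mulVec_mulVec]
  have hB1 : norm2 B ≤ 1 := norm2_le_of_sq_le zero_le_one fun z => by
    have := hXY (Y⁻¹ *ᵥ z)
    rw [hYz] at this
    rw [hBz]
    linarith
  have hinv : norm2 Y⁻¹ ≤ (301 / 100 * (q * g))⁻¹ := by
    refine norm2_inv_le (by positivity) hY fun z => (le_trans ?_ (hlow z))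
    have : 0 ≤ q ^ 2 * g ^ 2 := by positivity
    refine mul_le_mul_of_nonneg_right ?_ (dotProduct_self_nonneg z)
    rw [mul_pow, mul_pow]
    linarith
  have hW0 := norm2_nonneg W
  have hCn : norm2 C ≤ 201 / 1000 * q * norm2 W := by
    calc norm2 C ≤ norm2 (W * Y - X) * norm2 Y⁻¹ := norm2_mul_le _ _
      _ ≤ (121 / 100 * ν * g * norm2 W) * (301 / 100 * (q * g))⁻¹ :=
        mul_le_mul ((norm2_le_normF _).trans hres) hinv (norm2_nonneg _) (by positivity)
      _ = 121 / 301 * (ν / q) * norm2 W := by field_simp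
      _ ≤ 201 / 1000 * q * norm2 W := by
        refine mul_le_mul_of_nonneg_right ?_ hW0
        have : ν / q ≤ q / 2 := by
          rw [div_le_iff₀ hq]; linarith
        linarith
  have hW1 : norm2 W ≤ 1037 / 1000 := by
    have e1 : norm2 W ≤ norm2 B + norm2 C := by
      conv_lhs => rw [hsum]
      exact norm2_add_le _ _
    have e2 := mul_le_mul_of_nonneg_right hq1 hW0
    linarith
  refine ⟨hW1, ?_⟩
  have hB2 : ∀ z, (27 / 5 * q) ^ 2 * (z ⬝ᵥ z) ≤ (B *ᵥ z) ⬝ᵥ (B *ᵥ z) := fun z => by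
    have e1 := hup (Y⁻¹ *ᵥ z)
    rw [hYz] at e1
    rw [hBz]
    set y := Y⁻¹ *ᵥ z
    have hyy := dotProduct_self_nonneg y
    have e2 : 7396 * (q ^ 2 * (q ^ 2 * g ^ 2)) * (y ⬝ᵥ y) ≤ (X *ᵥ y) ⬝ᵥ (X *ᵥ y) := by
      refine le_trans (mul_le_mul_of_nonneg_right ?_ hyy) (hX y)
      have := pow_le_pow_left₀ (by positivity) hσ 2
      linarith
    have e3 : q ^ 2 ≤ 177 / 1000 * (177 / 1000) := by
      rw [sq]; exact mul_le_mul hq1 hq1 hq.le (by norm_num)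
    have e4 := mul_le_mul_of_nonneg_left e1 (sq_nonneg q)
    have e5 := mul_le_mul_of_nonneg_right e3 (dotProduct_self_nonneg (X *ᵥ y))
    have e6 := dotProduct_self_nonneg (X *ᵥ y)
    rw [mul_pow]
    linarith
  intro z
  have hCn' : norm2 C ≤ 21 / 100 * q := by
    refine hCn.trans ?_
    have := mul_le_mul_of_nonneg_left hW1 hq.le
    linarith
  have := mulVec_add_sq_ge (by linarith) hB2 hCn' z
  rw [← hsum] at this
  refine le_trans (mul_le_mul_of_nonneg_right ?_ (dotProduct_self_nonneg z)) this
  exact pow_le_pow_left₀ (by positivity) (by linarith) 2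

set_option maxHeartbeats 400000 in
/-- The shifted step: the Cholesky factor exists and is a good preconditioner. -/
theorem flSCholeskyQR_spec (fl : FlArith u) (h0 : 0 < u) (h1 : u < 1) (hn : 0 < n) (hnm : n ≤ m)
    (hm : m * n * u ≤ 1 / 64) (hnn : n * (n + 1) * u ≤ 1 / 64) {ε : ℝ}
    (hε : ε = m * n * u + n * (n + 1) * u) {X : Matrix (Fin m) (Fin n) ℝ} {g N σ : ℝ}
    (hg : 0 < g) (hgN : g ≤ N) (hσN : σ ≤ N) (hXg : ∀ j, ∑ i, X i j ^ 2 ≤ g ^ 2)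
    (hXN : norm2 X ≤ N) (hX : ∀ z, σ ^ 2 * (z ⬝ᵥ z) ≤ (X *ᵥ z) ⬝ᵥ (X *ᵥ z))
    (hσ : 86 * ε * g ≤ σ) :
    ∃ W Y, flSCholeskyQR fl (11 * ε * g ^ 2) X = some (W, Y) ∧ norm2 W ≤ 1037 / 1000 ∧
      (∀ z, (5 * Real.sqrt ε) ^ 2 * (z ⬝ᵥ z) ≤ (W *ᵥ z) ⬝ᵥ (W *ᵥ z)) ∧
      normF (W * Y - X) ≤ 63 / 50 * (n ^ 2 * u) * g ∧
      normF Y ≤ 119 / 100 * (Real.sqrt n * g) ∧ norm2 Y ≤ 27 / 25 * N := by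
  have hn1 : (1 : ℝ) ≤ n := by exact_mod_cast hn
  have hmn : (n : ℝ) ≤ m := by exact_mod_cast hnm
  have hν0 : 0 ≤ n ^ 2 * u := by positivity
  have hν1 : n ^ 2 * u ≤ n * (n + 1) * u := by nlinarith [mul_nonneg (by linarith : (0:ℝ) ≤ n) h0.le]
  have hν2 : n ^ 2 * u ≤ m * n * u := by
    have : (n : ℝ) ^ 2 ≤ m * n := by nlinarith
    exact mul_le_mul_of_nonneg_right this h0.le
  have huc : 2 * u ≤ n * (n + 1) * u := by
    refine mul_le_mul_of_nonneg_right ?_ h0.le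
    nlinarith
  have hua : u ≤ m * n * u := by
    have : (1 : ℝ) ≤ m * n := by nlinarith
    nlinarith
  obtain ⟨hm1, hm2⟩ := roundErr_bounds (k := m) h0.le h1 hn (by linarith)
  obtain ⟨hc1, hc2⟩ := roundErr_bounds (k := n + 1) h0.le h1 hn (by push_cast; linarith)
  obtain ⟨hd1, hd2⟩ := roundErr_bounds (k := n) h0.le h1 hn (by nlinarith)
  have hm0 := roundErr_nonneg h0.le h1 m
  have hc0 := roundErr_nonneg h0.le h1 (n + 1)
  have hd0 := roundErr_nonneg h0.le h1 n
  push_cast at hc2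
  set a := m * n * u with ha
  set c := n * (n + 1) * u with hc
  set ν := n ^ 2 * u with hν
  have hε0 : 0 < ε := by rw [hε]; linarith
  have hε1 : ε ≤ 1 / 32 := by rw [hε]; linarith
  have huε : u ≤ ε / 3 := by rw [hε]; linarith
  have hνε : ν ≤ ε / 2 := by rw [hε]; linarith
  have hg2 : 0 < g ^ 2 := by positivity
  have hεg : 0 < ε * g ^ 2 := by positivity
  have hεg1 : ε * g ^ 2 ≤ 1 / 32 * g ^ 2 := mul_le_mul_of_nonneg_right hε1 hg2.le
  have hsplit : ε * g ^ 2 = a * g ^ 2 + c * g ^ 2 := by rw [hε]; ring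
  have ha0 : 0 ≤ a * g ^ 2 := mul_nonneg (hν0.trans hν2) hg2.le
  have hc0' : 0 ≤ c * g ^ 2 := mul_nonneg (hν0.trans hν1) hg2.le
  have hXF : normF X ^ 2 ≤ n * g ^ 2 := normF_sq_le_of_col_le hXg
  set s := 11 * ε * g ^ 2 with hs
  set G := flMatMul fl Xᵀ X with hGdef
  have hG : normF (symUpper G - Xᵀ * X) ≤ 64 / 63 * (a * g ^ 2) := by
    refine (normF_symUpper_flGram_sub_le fl h0.le h1 X).trans ?_
    calc _ ≤ roundErr u m * (n * g ^ 2) := mul_le_mul_of_nonneg_left hXF hm0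
      _ = (n * roundErr u m) * g ^ 2 := by ring
      _ ≤ 64 / 63 * (n * m * u) * g ^ 2 := mul_le_mul_of_nonneg_right hm2 hg2.le
      _ = _ := by rw [ha]; ring
  have hGs : ∀ i, |G i i + s| ≤ 34 / 25 * g ^ 2 := fun i => by
    have e1 := abs_le.1 (flGram_diag_err fl h0.le h1 X i)
    have e2 : 0 ≤ ∑ t, X t i ^ 2 := Finset.sum_nonneg fun _ _ => sq_nonneg _
    have e3 := mul_le_mul_of_nonneg_right hm1 e2
    have e4 := hXg i
    rw [abs_le]
    constructor <;> linarith
  have hug : u * (34 / 25 * g ^ 2) ≤ 34 / 75 * (ε * g ^ 2) := by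
    have := mul_le_mul_of_nonneg_right huε hg2.le
    linarith
  set M := flShift fl G s with hM
  have hMn : norm2 (symUpper M - (Xᵀ * X + s • (1 : Matrix (Fin n) (Fin n) ℝ))) ≤
      147 / 100 * (ε * g ^ 2) := by
    refine (norm2_symUpper_flShift_sub_le fl (by positivity) h0.le hGs).trans ?_
    linarith
  have htr : ∑ i, M i i ≤ 69 / 50 * (n * g ^ 2) := by
    have e1 : ∀ i, M i i ≤ 69 / 50 * g ^ 2 := fun i => by
      have e2 := (abs_le.1 (fl.add_err (G i i) s)).2
      have e3 := hGs i
      have e4 := mul_le_mul_of_nonneg_left e3 h0.le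
      have e5 := (abs_le.1 e3).2
      have e6 : M i i = fl.add (G i i) s := by simp [hM, flShift]
      rw [e6]
      linarith
    refine (Finset.sum_le_sum fun i _ => e1 i).trans_eq ?_
    simp
    ring
  have h4 : 4 * roundErr u (n + 1) * (69 / 50 * (n * g ^ 2)) ≤ 6 * (ε * g ^ 2) := by
    have := mul_le_mul_of_nonneg_right hc2 hg2.le
    linarith
  obtain ⟨Y, hY, hup, hd, hYF, hYE⟩ := flCholesky_gram fl h0.le h1 (A := X)
    (M := M) (s := s) (η := 147 / 100 * (ε * g ^ 2)) (α := 0)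
    (τ := 69 / 50 * (n * g ^ 2)) (by linarith) hMn
    (fun z => by
      rw [zero_pow two_ne_zero, zero_mul]
      exact dotProduct_self_nonneg _) (by rw [hs]; linarith) htr (by
      have e2 : (0 ^ 2 + s - 147 / 100 * (ε * g ^ 2)) * (62 / 63) ≤
          (0 ^ 2 + s - 147 / 100 * (ε * g ^ 2)) * (1 - roundErr u (n + 1)) :=
        mul_le_mul_of_nonneg_left (by linarith) (by rw [hs]; linarith)
      rw [hs] at e2 ⊢
      linarith)
  have hYF' : normF Y ^ 2 ≤ 141 / 100 * (n * g ^ 2) := by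
    have e1 := mul_le_mul_of_nonneg_left hc1 (sq_nonneg (normF Y))
    have e2 : 0 ≤ n * g ^ 2 := by positivity
    linarith
  have hdet := isUnit_det_of_upper hup hd
  set E := Yᵀ * Y - (Xᵀ * X + s • (1 : Matrix (Fin n) (Fin n) ℝ)) with hEdef
  have hE : norm2 E ≤ 19 / 10 * (ε * g ^ 2) := by
    have e1 : E = (Yᵀ * Y - symUpper M) +
        (symUpper M - (Xᵀ * X + s • (1 : Matrix (Fin n) (Fin n) ℝ))) := by rw [hEdef]; abel
    have e2 := norm2_add_le (Yᵀ * Y - symUpper M)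
      (symUpper M - (Xᵀ * X + s • (1 : Matrix (Fin n) (Fin n) ℝ)))
    rw [← e1] at e2
    have e3 : roundErr u (n + 1) * normF Y ^ 2 ≤ 141 / 100 * (64 / 63) * (c * g ^ 2) := by
      have := mul_le_mul_of_nonneg_left hYF' hc0
      linarith [mul_le_mul_of_nonneg_right hc2 hg2.le]
    have e4 := (norm2_symUpper_flShift_sub_le fl (A := X) (by positivity) h0.le hGs)
    have e5 := (norm2_le_normF _).trans hYE
    linarith
  have hquad := mulVec_sq_of_gram_eq (A := X) (R := Y) (E := E) (s := s)
    (by rw [hEdef]; abel) hE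
  have hqe : Real.sqrt ε ^ 2 = ε := Real.sq_sqrt hε0.le
  have hrn : Real.sqrt n ^ 2 = n := Real.sq_sqrt (by linarith)
  have hYF1 : normF Y ≤ 119 / 100 * (Real.sqrt n * g) := by
    refine le_of_sq_le_sq (hYF'.trans ?_) (by positivity)
    rw [mul_pow, mul_pow, hrn]
    have : 0 ≤ n * g ^ 2 := by positivity
    linarith
  have hWY := normF_flSolve_mul_sub_le fl h0.le h1 hup (fun i => (hd i).ne') X
  set W := flSolve fl X Y with hW
  have hW0 := norm2_nonneg W
  have hres : normF (W * Y - X) ≤ 121 / 100 * ν * g * norm2 W := by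
    refine hWY.trans ?_
    calc roundErr u n * (normF W * normF Y)
        ≤ roundErr u n * ((Real.sqrt n * norm2 W) * (119 / 100 * (Real.sqrt n * g))) := by
          gcongr
          exacts [normF_nonneg _, normF_le_sqrt_mul_norm2 W]
      _ = 119 / 100 * (Real.sqrt n ^ 2 * roundErr u n) * g * norm2 W := by ring
      _ ≤ 121 / 100 * ν * g * norm2 W := by
          rw [hrn]
          gcongr ?_ * _ * _
          have : n * n * u = ν := by rw [hν]; ring
          rw [this] at hd2
          linarith
  obtain ⟨hW1, hW2⟩ := shifted_preconditioner (X := X) (W := W) (Y := Y) (g := g)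
    (q := Real.sqrt ε) (ν := ν) (σ := σ) hg (Real.sqrt_pos.2 hε0)
    (Real.sqrt_le_iff.2 ⟨by norm_num, hε1.trans (by norm_num)⟩) (by rw [hqe]; exact hνε) hν0 hdet
    (by rw [hqe]; exact hσ) hX
    (fun z => by
      have e1 := (abs_le.1 (hquad z)).1
      have e2 := dotProduct_self_nonneg (X *ᵥ z)
      rw [hqe]
      linarith)
    (fun z => by
      have e1 := (abs_le.1 (hquad z)).1
      have e2 := mul_nonneg hεg.le (dotProduct_self_nonneg z)
      linarith)
    (fun z => by
      have e1 := (abs_le.1 (hquad z)).2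
      rw [hqe]
      linarith) hres
  refine ⟨W, Y, ?_, hW1, hW2, hres.trans ?_, hYF1, ?_⟩
  · simp [flSCholeskyQR, ← hGdef, ← hM, hY, hW]
  · have := mul_le_mul_of_nonneg_left hW1 (mul_nonneg hν0 hg.le)
    have := mul_nonneg hν0 hg.le
    linarith
  · have hN : 0 < N := hg.trans_le hgN
    refine norm2_le_of_sq_le (by positivity) fun z => ?_
    have e1 := (abs_le.1 (hquad z)).2
    have e2 := mulVec_sq_le_of_norm2_le hXN z
    have e3 := dotProduct_self_nonneg z
    have e4 : ε * g ^ 2 ≤ 1 / 86 * N ^ 2 := by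
      have : ε * g ≤ 1 / 86 * N := by linarith
      calc ε * g ^ 2 = (ε * g) * g := by ring
        _ ≤ (1 / 86 * N) * N := mul_le_mul this hgN hg.le (by positivity)
        _ = _ := by ring
    have e5 := mul_le_mul_of_nonneg_right e4 e3
    have e6 := mul_nonneg (sq_nonneg N) e3
    linarith

end Shifted


section Main

variable {u : ℝ} {m n : ℕ}

/-- The residual of a product of three approximate triangular factorizations. -/
theorem residual_le {X W V Q : Matrix (Fin m) (Fin n) ℝ} {Y D J Z R : Matrix (Fin n) (Fin n) ℝ}
    {ν N g r φ : ℝ} (hν0 : 0 ≤ ν) (hν1 : ν ≤ 1 / 64) (hN : 0 ≤ N) (hg : 0 ≤ g) (hr : 1 ≤ r)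
    (hφ0 : 0 ≤ φ) (hφ : r ^ 2 * φ ≤ 64 / 63 * ν)
    (hWY : normF (W * Y - X) ≤ 63 / 50 * ν * g) (hYF : normF Y ≤ 119 / 100 * (r * g))
    (hY : norm2 Y ≤ 27 / 25 * N)
    (hVD : normF (V * D - W) ≤ 26 / 25 * ν * (1037 / 1000) * norm2 V) (hV : norm2 V ≤ 21 / 20)
    (hDF : normF D ≤ 51 / 50 * (r * (1037 / 1000))) (hD : norm2 D ≤ 51 / 50 * (1037 / 1000))
    (hQJ : normF (Q * J - V) ≤ 26 / 25 * ν * (21 / 20) * norm2 Q) (hQ : norm2 Q ≤ 11 / 10)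
    (hJF : normF J ≤ 51 / 50 * (r * (21 / 20))) (hJ : norm2 J ≤ 51 / 50 * (21 / 20))
    (hZ : normF (Z - J * D) ≤ φ * (normF J * normF D))
    (hR : normF (R - Z * Y) ≤ φ * (normF Z * normF Y)) :
    normF (Q * R - X) ≤ 4 * ν * N + 3 * ν * g := by
  have e : Q * R - X = (W * Y - X) + ((V * D - W) * Y + ((Q * J - V) * (D * Y) +
      (Q * ((Z - J * D) * Y) + Q * (R - Z * Y)))) := by
    simp only [Matrix.sub_mul, Matrix.mul_sub, Matrix.mul_assoc]
    abel
  have hνN : 0 ≤ ν * N := mul_nonneg hν0 hN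
  have hνg : 0 ≤ ν * g := mul_nonneg hν0 hg
  have hr0 : 0 ≤ r := by linarith
  have t2 : normF ((V * D - W) * Y) ≤ 123 / 100 * (ν * N) := by
    calc _ ≤ normF (V * D - W) * norm2 Y := normF_mul_le_mul_norm2 _ _
      _ ≤ (26 / 25 * ν * (1037 / 1000) * (21 / 20)) * (27 / 25 * N) :=
        mul_le_mul (hVD.trans (mul_le_mul_of_nonneg_left hV (by positivity))) hY (norm2_nonneg _)
          (by positivity)
      _ ≤ _ := by linarith
  have t3 : normF ((Q * J - V) * (D * Y)) ≤ 138 / 100 * (ν * N) := by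
    calc _ ≤ normF (Q * J - V) * norm2 (D * Y) := normF_mul_le_mul_norm2 _ _
      _ ≤ (26 / 25 * ν * (21 / 20) * (11 / 10)) * ((51 / 50 * (1037 / 1000)) * (27 / 25 * N)) :=
        mul_le_mul (hQJ.trans (mul_le_mul_of_nonneg_left hQ (by positivity)))
          ((norm2_mul_le _ _).trans (mul_le_mul hD hY (norm2_nonneg _) (by norm_num)))
          (norm2_nonneg _) (by positivity)
      _ ≤ _ := by linarith
  have hZ' : normF (Z - J * D) ≤ 2302 / 2000 * ν := by
    calc _ ≤ φ * (normF J * normF D) := hZ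
      _ ≤ φ * ((51 / 50 * (r * (21 / 20))) * (51 / 50 * (r * (1037 / 1000)))) :=
        mul_le_mul_of_nonneg_left (mul_le_mul hJF hDF (normF_nonneg _) (by positivity)) hφ0
      _ = (51 / 50) ^ 2 * (21 / 20) * (1037 / 1000) * (r ^ 2 * φ) := by ring
      _ ≤ _ := by linarith
  have t4 : normF (Q * ((Z - J * D) * Y)) ≤ 138 / 100 * (ν * N) := by
    calc _ ≤ norm2 Q * normF ((Z - J * D) * Y) := normF_mul_le_norm2_mul _ _
      _ ≤ 11 / 10 * ((2302 / 2000 * ν) * (27 / 25 * N)) :=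
        mul_le_mul hQ ((normF_mul_le_mul_norm2 _ _).trans
          (mul_le_mul hZ' hY (norm2_nonneg _) (by positivity))) (normF_nonneg _) (by norm_num)
      _ ≤ _ := by linarith
  have hZF : normF Z ≤ 6 / 5 * r := by
    have e1 : Z = (Z - J * D) + J * D := by abel
    have e2 := normF_add_le (Z - J * D) (J * D)
    rw [← e1] at e2
    have e3 : normF (J * D) ≤ (51 / 50 * (21 / 20)) * (51 / 50 * (r * (1037 / 1000))) :=
      (normF_mul_le_norm2_mul _ _).trans
        (mul_le_mul hJ hDF (normF_nonneg _) (by norm_num))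
    linarith
  have t5 : normF (Q * (R - Z * Y)) ≤ 8 / 5 * (ν * g) := by
    calc _ ≤ norm2 Q * normF (R - Z * Y) := normF_mul_le_norm2_mul _ _
      _ ≤ 11 / 10 * (φ * ((6 / 5 * r) * (119 / 100 * (r * g)))) :=
        mul_le_mul hQ (hR.trans (mul_le_mul_of_nonneg_left
          (mul_le_mul hZF hYF (normF_nonneg _) (by positivity)) hφ0)) (normF_nonneg _)
          (by norm_num)
      _ = 11 / 10 * (6 / 5) * (119 / 100) * ((r ^ 2 * φ) * g) := by ring
      _ ≤ _ := by
        have := mul_le_mul_of_nonneg_right hφ hg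
        linarith
  rw [e]
  have a1 := normF_add_le (W * Y - X) ((V * D - W) * Y + ((Q * J - V) * (D * Y) +
      (Q * ((Z - J * D) * Y) + Q * (R - Z * Y))))
  have a2 := normF_add_le ((V * D - W) * Y) ((Q * J - V) * (D * Y) +
      (Q * ((Z - J * D) * Y) + Q * (R - Z * Y)))
  have a3 := normF_add_le ((Q * J - V) * (D * Y)) (Q * ((Z - J * D) * Y) + Q * (R - Z * Y))
  have a4 := normF_add_le (Q * ((Z - J * D) * Y)) (Q * (R - Z * Y))
  linarith

theorem norm_bounds_of_orthogonality {V : Matrix (Fin m) (Fin n) ℝ} {δ : ℝ}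
    (h : normF (Vᵀ * V - 1) ≤ δ) (z : Fin n → ℝ) :
    (1 - δ) * (z ⬝ᵥ z) ≤ (V *ᵥ z) ⬝ᵥ (V *ᵥ z) ∧
      (V *ᵥ z) ⬝ᵥ (V *ᵥ z) ≤ (1 + δ) * (z ⬝ᵥ z) := by
  have e1 : (V *ᵥ z) ⬝ᵥ (V *ᵥ z) = z ⬝ᵥ z + z ⬝ᵥ ((Vᵀ * V - 1) *ᵥ z) := by
    rw [mulVec_dotProduct_mulVec, Matrix.sub_mulVec, Matrix.one_mulVec, dotProduct_sub]
    ring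
  have e2 := abs_le.1 ((abs_dotProduct_mulVec_le (Vᵀ * V - 1) z).trans
    (mul_le_mul_of_nonneg_right ((norm2_le_normF _).trans h) (dotProduct_self_nonneg z)))
  rw [e1]
  constructor <;> linarith

/-- Shifted CholeskyQR3 in floating-point arithmetic. -/
theorem flSCholeskyQR3_spec (fl : FlArith u) (h0 : 0 < u) (h1 : u < 1) (hn : 0 < n) (hnm : n ≤ m)
    (hm : m * n * u ≤ 1 / 64) (hnn : n * (n + 1) * u ≤ 1 / 64) {ε : ℝ}
    (hε : ε = m * n * u + n * (n + 1) * u) {X : Matrix (Fin m) (Fin n) ℝ} {g N σ : ℝ}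
    (hg : 0 < g) (hgN : g ≤ N) (hσN : σ ≤ N) (hXg : ∀ j, ∑ i, X i j ^ 2 ≤ g ^ 2)
    (hXN : norm2 X ≤ N) (hX : ∀ z, σ ^ 2 * (z ⬝ᵥ z) ≤ (X *ᵥ z) ⬝ᵥ (X *ᵥ z))
    (hσ : 86 * ε * g ≤ σ) :
    ∃ Q R, flSCholeskyQR3 fl (11 * ε * g ^ 2) X = some (Q, R) ∧
      normF (Qᵀ * Q - 1) ≤ 6 * ε ∧
      normF (Q * R - X) ≤ 4 * (n ^ 2 * u) * N + 3 * (n ^ 2 * u) * g := by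
  have hn1 : (1 : ℝ) ≤ n := by exact_mod_cast hn
  have hmn : (n : ℝ) ≤ m := by exact_mod_cast hnm
  have hν0 : 0 ≤ n ^ 2 * u := by positivity
  have hν1 : n ^ 2 * u ≤ n * (n + 1) * u := by nlinarith [mul_nonneg (by linarith : (0:ℝ) ≤ n) h0.le]
  have hν2 : n ^ 2 * u ≤ m * n * u := by
    have : (n : ℝ) ^ 2 ≤ m * n := by nlinarith
    exact mul_le_mul_of_nonneg_right this h0.le
  have hε0 : 0 < ε := by rw [hε]; positivity
  have hε1 : ε ≤ 1 / 32 := by rw [hε]; linarith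
  have hνε : n ^ 2 * u ≤ ε / 2 := by rw [hε]; linarith
  obtain ⟨W, Y, hWYeq, hW2, hWlow, hWY, hYF, hY2⟩ :=
    flSCholeskyQR_spec fl h0 h1 hn hnm hm hnn hε hg hgN hσN hXg hXN hX hσ
  have hqe : Real.sqrt ε ^ 2 = ε := Real.sq_sqrt hε0.le
  have hq0 : 0 < Real.sqrt ε := Real.sqrt_pos.2 hε0
  have hq1 : Real.sqrt ε ≤ 177 / 1000 :=
    Real.sqrt_le_iff.2 ⟨by norm_num, hε1.trans (by norm_num)⟩
  obtain ⟨V, D, hVDeq, hV2, hVorth, hVD, hDF, hD2⟩ :=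
    flCholeskyQR_spec fl h0.le h1 hn hnm hm hnn hε (A := W) (α := 5 * Real.sqrt ε)
      (β := 1037 / 1000) (by positivity) (by norm_num) hWlow hW2
      (by rw [mul_pow, hqe]; linarith)
  have hVorth' : normF (Vᵀ * V - 1) ≤ 1 / 10 := by
    refine hVorth.trans ?_
    have e1 : ε * (1037 / 1000) ^ 2 / (5 * Real.sqrt ε) ^ 2 = (1037 / 1000) ^ 2 / 25 := by
      rw [mul_pow, hqe]
      field_simp
      norm_num
    have e2 : n ^ 2 * u * (1037 / 1000) / (5 * Real.sqrt ε) ≤ 1037 / 10000 * Real.sqrt ε := by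
      rw [div_le_iff₀ (by positivity)]
      have : 1037 / 10000 * Real.sqrt ε * (5 * Real.sqrt ε) =
        1037 / 2000 * (Real.sqrt ε ^ 2) := by ring
      rw [this, hqe]
      linarith
    rw [e1]
    linarith
  have hVb := norm_bounds_of_orthogonality hVorth'
  have hV2' : norm2 V ≤ 21 / 20 := norm2_le_of_sq_le (by norm_num) fun z => by
    have := (hVb z).2
    have := dotProduct_self_nonneg z
    linarith
  obtain ⟨Q, J, hQJeq, hQ2, hQorth, hQJ, hJF, hJ2⟩ :=
    flCholeskyQR_spec fl h0.le h1 hn hnm hm hnn hε (A := V) (α := 237 / 250) (β := 21 / 20)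
      (by norm_num) (by norm_num)
      (fun z => by
        have := (hVb z).1
        have := dotProduct_self_nonneg z
        linarith) hV2' (by linarith)
  refine ⟨Q, flMatMul fl (flMatMul fl J D) Y, ?_, hQorth.trans ?_, ?_⟩
  · simp [flSCholeskyQR3, flCholeskyQR2, hWYeq, hVDeq, hQJeq]
  · have e1 : ε * (21 / 20) ^ 2 / (237 / 250) ^ 2 ≤ 5 / 4 * ε := by
      rw [div_le_iff₀ (by norm_num)]
      norm_num
      linarith
    have e2 : n ^ 2 * u * (21 / 20) / (237 / 250) ≤ 10 / 9 * (n ^ 2 * u) := by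
      rw [div_le_iff₀ (by norm_num)]
      linarith
    linarith
  · have hd := (roundErr_bounds (k := n) h0.le h1 hn (by nlinarith)).2
    have hrn : Real.sqrt n ^ 2 = n := Real.sq_sqrt (by linarith)
    exact residual_le hν0 (hν1.trans hnn) (hg.le.trans hgN) hg.le (Real.one_le_sqrt.2 hn1)
      (roundErr_nonneg h0.le h1 n) (by rw [hrn]; linarith) hWY hYF hY2 hVD hV2' hDF hD2 hQJ hQ2
      hJF hJ2 (normF_flMatMul_sub_le fl h0.le h1 _ _) (normF_flMatMul_sub_le fl h0.le h1 _ _)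

theorem sum_col_sq_le_nnz_mul (X : Matrix (Fin m) (Fin n) ℝ) (j : Fin n) :
    ∑ i, X i j ^ 2 ≤ nnzCol X j * maxAbs X ^ 2 := by
  classical
  have hle : ∀ i, X i j ^ 2 ≤ maxAbs X ^ 2 := fun i => by
    have : |X i j| ≤ maxAbs X :=
      le_ciSup (f := fun ij : Fin m × Fin n => |X ij.1 ij.2|) (Set.finite_range _).bddAbove (i, j)
    rw [← sq_abs]
    exact pow_le_pow_left₀ (abs_nonneg _) this 2
  have hc : nnzCol X j = (Finset.univ.filter fun i => X i j ≠ 0).card := by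
    rw [nnzCol, Set.ncard_eq_toFinset_card']
    congr 1
    ext i
    simp
  rw [hc, ← nsmul_eq_mul, ← Finset.sum_const, Finset.sum_filter]
  refine Finset.sum_le_sum fun i _ => ?_
  split_ifs with h
  · exact hle i
  · rw [not_not.1 h]; simp

theorem shiftJs_of_isT2 {X : Matrix (Fin m) (Fin n) ℝ} {t₁ t₂ : ℕ} (hX : IsT2 X t₁ t₂) :
    shiftJs X 0 t₁ t₂ = 11 * (m * n * machEps + n * (n + 1) * machEps) * normG X ^ 2 := by
  obtain ⟨-, -, -, -, D, hD, -, hcol⟩ := hX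
  rw [Finset.card_eq_zero] at hD
  subst hD
  have hu : 0 ≤ machEps := by unfold machEps; positivity
  have hG : normG X ^ 2 ≤ t₂ * maxAbs X ^ 2 := by
    refine (Real.le_sqrt (normG_nonneg X) (by positivity)).1 (normG_le (Real.sqrt_nonneg _) fun j => ?_)
    rw [Real.sq_sqrt (by positivity)]
    refine (sum_col_sq_le_nnz_mul X j).trans (mul_le_mul_of_nonneg_right ?_ (sq_nonneg _))
    exact_mod_cast hcol j (Finset.notMem_empty j)
  refine min_eq_right ?_
  have h : 0 ≤ 11 * ((m * n * machEps + n * (n + 1) * machEps)) := by positivity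
  refine (mul_le_mul_of_nonneg_left hG h).trans_eq ?_
  push_cast
  ring

end Main

end SparseCholeskyQR

open SparseCholeskyQR
theorem mainTheorem4 {m n : ℕ} (X : Matrix (Fin m) (Fin n) ℝ) (t₁ t₂ : ℕ)
    (hX : IsT2 X t₁ t₂) :
    shiftJs X 0 t₁ t₂ = 11 * (m * n * machEps + n * (n + 1) * machEps) * normG X ^ 2 ∧
    (X.rank = n →
      m * n * machEps ≤ 1 / 64 →
      n * (n + 1) * machEps ≤ 1 / 64 →
      (1 / Real.sqrt n ≤ ratioP X ∧ ratioP X ≤ 1) ∧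
      1 / (86 * ratioP X * (m * n * machEps + n * (n + 1) * machEps)) ≤
        1 / (4.89 * ratioP X * n ^ 2 * machEps) ∧
      (kappa2 X ≤ 1 / (86 * ratioP X * (m * n * machEps + n * (n + 1) * machEps)) →
        ∀ fl : FlArith machEps,
          ∃ (Q : Matrix (Fin m) (Fin n) ℝ) (R : Matrix (Fin n) (Fin n) ℝ),
            flSCholeskyQR3 fl (shiftJs X 0 t₁ t₂) X = some (Q, R) ∧
            normF (Q.transpose * Q - 1) ≤ 6 * (m * n * machEps + n * (n + 1) * machEps) ∧
            normF (Q * R - X) ≤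
              (6.57 * ratioP X + 4.81) * n ^ 2 * machEps * norm2 X)) := by
  refine ⟨shiftJs_of_isT2 hX, fun hrank hm hnn => ?_⟩
  rw [shiftJs_of_isT2 hX]
  have hn : 0 < n := hX.1
  have hn1 : (1 : ℝ) ≤ n := by exact_mod_cast hn
  have hnm : n ≤ m := by simpa [hrank] using X.rank_le_height
  have hmn : (n : ℝ) ≤ m := by exact_mod_cast hnm
  have hu0 : 0 < machEps := by unfold machEps; positivity
  have hu1 : machEps < 1 := by unfold machEps; norm_num
  have hσ0 := sigmaMin_pos hn hrank
  have hσX := sigmaMin_sq_mul_le X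
  have hσN : sigmaMin X ≤ norm2 X := by
    have h1 := (hσX (Pi.single ⟨0, hn⟩ 1)).trans (mulVec_sq_le X _)
    simp only [single_dotProduct, Pi.single_eq_same, mul_one] at h1
    exact le_of_sq_le_sq h1 (norm2_nonneg X)
  have hN0 : 0 < norm2 X := hσ0.trans_le hσN
  have hrn : 0 < Real.sqrt n := Real.sqrt_pos.2 (by linarith)
  have hNg := norm2_le_sqrt_mul_normG X
  have hg0 : 0 < normG X := pos_of_mul_pos_right (hN0.trans_le hNg) hrn.le
  have hp0 : 0 < ratioP X := div_pos hg0 hN0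
  have hpN : ratioP X * norm2 X = normG X := div_mul_cancel₀ _ hN0.ne'
  have hε0 : 0 < m * n * machEps + n * (n + 1) * machEps := by positivity
  refine ⟨⟨?_, div_le_one_of_le₀ (normG_le_norm2 X) hN0.le⟩, ?_, fun hκ fl => ?_⟩
  · rw [ratioP, div_le_div_iff₀ hrn hN0]
    linarith
  · refine one_div_le_one_div_of_le (by positivity) ?_
    have h1 : n ^ 2 * machEps ≤ m * n * machEps + n * (n + 1) * machEps := by
      have : (n : ℝ) ^ 2 ≤ m * n + n * (n + 1) := by nlinarith
      have := mul_le_mul_of_nonneg_right this hu0.le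
      linarith
    have h2 := mul_le_mul_of_nonneg_left h1 hp0.le
    have h3 : 0 ≤ ratioP X * (n ^ 2 * machEps) := by positivity
    norm_num
    linarith
  · have hσ : 86 * (m * n * machEps + n * (n + 1) * machEps) * normG X ≤ sigmaMin X := by
      rw [kappa2, div_le_div_iff₀ hσ0 (by positivity), one_mul] at hκ
      rw [← hpN]
      linarith
    obtain ⟨Q, R, hQR, horth, hres⟩ := flSCholeskyQR3_spec fl hu0 hu1 hn hnm hm hnn rfl hg0
      (normG_le_norm2 X) hσN (sum_col_sq_le_normG_sq X) le_rfl hσX hσ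
    refine ⟨Q, R, hQR, horth, hres.trans ?_⟩
    rw [← hpN]
    have h1 : 0 ≤ n ^ 2 * machEps * norm2 X := by positivity
    have h2 : 0 ≤ n ^ 2 * machEps * (ratioP X * norm2 X) := by positivity
    norm_num
    linarith
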